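/- **Cutting and stacking.** Let $r_n\ge 1$ and $s_{n,i}\ge 0$ ($n\ge 1$, $0\le i\le r_n$) be integers. Let $C_1$ be the single interval $[0,1)$. Given the column $C_n$, a stack of $h_n$ intervals (levels) of equal length, cut it by $r_n$ vertical cuts into $r_n+1$ subcolumns of equal width, put $s_{n,i}$ spacers (intervals of the same width, the leftmost ones not in $C_n$) on top of the $i$-th subcolumn, and stack the subcolumns, right on top of left, to get $C_{n+1}$. Each column defines a map on all its levels but the top one, by translating each level onto the next one above it. The common extension $T$ of these maps, acting on the union $Y$ of all columns with Lebesgue measure, is a *rank-one transformation*; it is *on a probability space* if $Y$ has finite measure, and the measure is then normalized to a probability measure $\mu$. Put $B_1=0$ and $B_{n+1}=B_n1^{s_{n,0}}B_n1^{s_{n,1}}\cdots B_n1^{s_{n,r_n}}$, so that $B_n$ has length $h_n$. The *rank-one subshift* associated to $T$ is the set $X\subset\{0,1\}^{\mathbb Z}$ of all biinfinite sequences every subword of which is a subword of some $B_n$. Its *empirical measure* $\nu$ gives the cylinder of a word $w$ the limiting frequency of $w$ in $B_n$ as $n\to\infty$. Write $p(q)$ for the number of words of length $q$ that occur in elements of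 $X$. A measure-preserving transformation is *totally ergodic* if all its powers with exponent $k\ge 1$ are ergodic. **Theorem.** For every $f:\mathbb N\to\mathbb R$ with $f(q)\to\infty$ there is a rank-one transformation $T$ on a probability space $(Y,\mu)$ that is totally ergodic, whose associated rank-one subshift $X$ has an empirical measure $\nu$, a probability measure carried by $X$ for which the shift is totally ergodic, and such that $$p(q)<1.5\,q+f(q)\ \text{ for all sufficiently large } q,\qquad p(h_n)<h_n+f(h_n)\ \text{ for all } n\ge 2 .$$ -/

import Mathlib

open Filter Topology MeasureTheory Set

/-! ### Subshifts and word complexity -/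

/-- The left shift on biinfinite sequences. -/
def shift {A : Type*} (x : ℤ → A) : ℤ → A := fun k => x (k + 1)

/-- The word of length `l` that occurs in `x` starting at position `k`. -/
def wordAt {A : Type*} (x : ℤ → A) (k : ℤ) (l : ℕ) : List A :=
  List.ofFn fun i : Fin l => x (k + (i : ℤ))

/-- The language of `X`: all words that occur in some element of `X`. -/
def language {A : Type*} (X : Set (ℤ → A)) : Set (List A) :=
  {w | ∃ x ∈ X, ∃ k : ℤ, wordAt x k w.length = w}

/-- The word complexity function of `X`: the number of words of length `q` in the language. -/
noncomputable def complexity {A : Type*} (X : Set (ℤ → A)) (q : ℕ) : ℕ :=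
  {w ∈ language X | w.length = q}.ncard

/-- The cylinder of all sequences in which `w` occurs at position `k`. -/
def wordCylinder {A : Type*} (k : ℤ) (w : List A) : Set (ℤ → A) :=
  {x | wordAt x k w.length = w}

/-- A transformation is totally ergodic when all its positive powers are ergodic (Mathlib's
`Ergodic` includes that the map is measurable and preserves the measure). -/
def TotallyErgodic {Y : Type*} [MeasurableSpace Y] (S : Y → Y) (μ : Measure Y) : Prop :=
  ∀ k : ℕ, 1 ≤ k → Ergodic S^[k] μ

/-! ### Rank-one transformations by cutting and stacking -/

/-- The data of a cutting and stacking construction, indexed by `n ≥ 1` (the values at `n = 0` are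
never used): column `n` is cut by `r n ≥ 1` cuts into `r n + 1` subcolumns, and `s n i` spacers are
put above the `i`-th subcolumn, `0 ≤ i ≤ r n`. -/
structure RankOne where
  /-- the cut sequence -/
  r : ℕ → ℕ
  /-- the spacer sequence -/
  s : ℕ → ℕ → ℕ
  one_le_r : ∀ n, 1 ≤ n → 1 ≤ r n

namespace RankOne

/-- The words `B_n`: `B_1 = 0` and `B_{n+1} = B_n 1^{s_{n,0}} B_n 1^{s_{n,1}} ⋯ B_n 1^{s_{n,r_n}}`.
(`B_0` is an unused empty word.) -/
def block (T : RankOne) : ℕ → List (Fin 2)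
  | 0 => []
  | 1 => [0]
  | n + 2 => (List.range (T.r (n + 1) + 1)).flatMap fun i : ℕ =>
      T.block (n + 1) ++ List.replicate (T.s (n + 1) i) 1

/-- The height `h_n` of the `n`-th column, which is the length of `B_n`. -/
def height (T : RankOne) (n : ℕ) : ℕ := (T.block n).length

/-- The common length of the levels of the `n`-th column. -/
noncomputable def width (T : RankOne) (n : ℕ) : ℝ :=
  1 / ∏ j ∈ Finset.Ico 1 n, ((T.r j : ℝ) + 1)

/-- The left endpoints of the levels of the `n`-th column, from bottom to top. The first column is
the single level `[0, 1)`. To pass from column `n` to column `n + 1`, cut every level into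
`r n + 1` intervals of equal length; subcolumn `i` consists of the `i`-th pieces from the left. Put
`s n i` spacers above subcolumn `i`, and stack the subcolumns, right on top of left. Column `n`
fills `[0, h_n * width n)`, and the spacers are the leftmost intervals to the right of it. -/
noncomputable def lefts (T : RankOne) : ℕ → List ℝ
  | 0 => []
  | 1 => [0]
  | n + 2 => (List.range (T.r (n + 1) + 1)).flatMap fun i : ℕ =>
      (T.lefts (n + 1)).map (fun a : ℝ => a + (i : ℝ) * T.width (n + 2)) ++
      (List.range (T.s (n + 1) i)).map fun k : ℕ =>
        T.height (n + 1) * T.width (n + 1) +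
          (((∑ i' ∈ Finset.range i, T.s (n + 1) i' : ℕ) : ℝ) + (k : ℝ)) * T.width (n + 2)

/-- The left endpoint of the `j`-th level of the `n`-th column (for `j < h_n`). -/
noncomputable def left (T : RankOne) (n j : ℕ) : ℝ := (T.lefts n).getD j 0

/-- The `j`-th level of the `n`-th column (for `j < h_n`). -/
def level (T : RankOne) (n j : ℕ) : Set ℝ := Ico (T.left n j) (T.left n j + T.width n)

/-- The space on which the transformation acts, the union of all levels of all columns. -/
def space (T : RankOne) : Set ℝ := ⋃ n, ⋃ j < T.height n, T.level n j

/-- `x` lies in a level of some column, not the top one, and the translation that carries this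
level onto the next one above it carries `x` to `y`. -/
def Step (T : RankOne) (x y : ℝ) : Prop :=
  ∃ n j, j + 1 < T.height n ∧ x ∈ T.level n j ∧ y = x + (T.left n (j + 1) - T.left n j)

open Classical in
/-- The rank-one transformation: the common extension of the partial maps given by the columns.
Inside the space these define it off a null set; points at which it is not defined are fixed. -/
noncomputable def map (T : RankOne) (x : ℝ) : ℝ :=
  if h : ∃ y, T.Step x y then h.choose else x

/-- Lebesgue measure on the space, normalized to total mass one. This is a probability measure
exactly when the space has finite Lebesgue measure (otherwise it is the zero measure). -/
noncomputable def measure (T : RankOne) : Measure ℝ :=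
  (volume T.space)⁻¹ • volume.restrict T.space

/-! ### The symbolic model -/

/-- The associated subshift: all biinfinite sequences every subword of which is a subword of
some `B_n`. -/
def subshift (T : RankOne) : Set (ℤ → Fin 2) :=
  {x | ∀ (k : ℤ) (l : ℕ), ∃ n, wordAt x k l <:+: T.block n}

/-- The number of `j < len(B_n) - len(w)` such that `w` occurs in `B_n` at position `j`
(counted from `0`). -/
def count (T : RankOne) (n : ℕ) (w : List (Fin 2)) : ℕ :=
  ((Finset.range (T.height n - w.length)).filter fun j =>
    ((T.block n).drop j).take w.length = w).card

/-- `ν` is the empirical measure: the measure of the cylinder of a word `w` (at any position) is the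
limiting frequency of `w` in `B_n`. -/
def IsEmpiricalMeasure (T : RankOne) (ν : Measure (ℤ → Fin 2)) : Prop :=
  ∀ (w : List (Fin 2)) (k : ℤ),
    Tendsto (fun n => (T.count n w : ℝ) / ((T.height n : ℝ) - (w.length : ℝ))) atTop
      (𝓝 (ν.real (wordCylinder k w)))

end RankOne

/-! Take B_{n+1} = D_n ⋯ D_n with K_n copies of D_n = B_n1B_n1⋯1B_n, which has P_n copies of B_n,
and let h_n, d_n be the lengths of B_n, D_n. The numbers P_n and K_n are multiples of n!, chosen so
large that f exceeds h_n from d_n on and exceeds d_n from h_{n+1} on (`exists_parameters`). At most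
one spacer is put on each subcolumn, so the space has finite measure.

Complexity. A word of X of length q ≤ h_{n+1} meets at most two consecutive copies of B_{n+1}, hence
occurs in ⋯DDD⋯ or in ⋯DD1DD⋯ with D = D_n (`sparse_nearPeriodic`). Counting starting positions
relative to the defect gives p(q) ≤ q + d_n. This is improved by noting that long stretches around a
defect are periodic: D1D is a piece of ⋯B1B1⋯, and BB is a piece of ⋯CCC⋯ with C = D_{n-1}. For h_n
< q < h_{n+1} the bounds are 2q + d_{n-1} - h_n - 1 and q + h_n up to d_n, and 2q + h_n - d_n - 1
and q + d_n beyond. Switching near 2h_n and 2d_n keeps all of them below 3q/2 plus an error d_{n-1}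
or h_n, which f(q) absorbs.

Total ergodicity. Let A be invariant under T^l and n ≥ l. In column n+1 the measure of A in a level
depends only on the height mod l. Copy number P_n q + u of B_n in B_{n+1} starts at a height
congruent to u(h_n + 1) - q mod l, because l divides P_n and each of the q junctions of two D's
lacks a spacer. As q runs over K_n values, a multiple of l, all residues are hit equally often, so A
has the same measure in all levels of column n (`sparse_uniform`). A set with this property for all
large n has constant density, hence is null or conull (`ae_empty_or_univ_of_uniform`).

Symbolic model. The measure ν is the distribution of the 0-1 coding of orbits. It is a factor of T,
so it inherits total ergodicity, and word frequencies in B_n are measures of unions of levels. -/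

namespace RankOne

/-! ### Windows of periodic sequences with a defect -/

/-- The periodic biinfinite sequence `⋯LLL⋯`, with a copy of `L` starting at `0`. -/
def per (L : List (Fin 2)) (t : ℤ) : Fin 2 := L.getD (t % (L.length : ℤ)).toNat 0

/-- The biinfinite sequence `⋯LL1LL⋯`, with the inserted `1` at position `0`. -/
def ins (L : List (Fin 2)) (t : ℤ) : Fin 2 :=
  if t < 0 then per L t else if t = 0 then 1 else per L (t - 1)

/-- The biinfinite sequence `⋯L1L1LL1L1L⋯`, with the two adjacent copies of `L` meeting at `0`. -/
def jun (L : List (Fin 2)) (t : ℤ) : Fin 2 :=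
  if t < 0 then per (L ++ [1]) (t - 1) else per (L ++ [1]) t

lemma per_congr (L : List (Fin 2)) {s t : ℤ} (h : s % (L.length : ℤ) = t % (L.length : ℤ)) :
    per L s = per L t := by
  simp only [per, h]

lemma per_of_eq_add {L : List (Fin 2)} {s t : ℤ} (h : s = t + L.length) : per L s = per L t :=
  per_congr L (by simp [h])

lemma per_append_one_of_eq_add {L : List (Fin 2)} {s t : ℤ} (h : s = t + L.length + 1) :
    per (L ++ [1]) s = per (L ++ [1]) t :=
  per_of_eq_add (by rw [h, List.length_append, List.length_singleton]; push_cast; ring)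

lemma per_of_lt {L : List (Fin 2)} {t : ℕ} (h : t < L.length) : per L t = L.getD t 0 := by
  have : ((t : ℤ) % (L.length : ℤ)).toNat = t := by
    rw [Int.emod_eq_of_lt (by positivity) (by exact_mod_cast h)]; simp
  simp only [per, this]

lemma getD_flatten_replicate (L : List (Fin 2)) (m i : ℕ) (hi : i < m * L.length) :
    (List.replicate m L).flatten.getD i 0 = L.getD (i % L.length) 0 := by
  induction m generalizing i with
  | zero => simp at hi
  | succ m ih =>
    rw [List.replicate_succ, List.flatten_cons]
    by_cases h : i < L.length
    · rw [List.getD_append _ _ _ _ h, Nat.mod_eq_of_lt h]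
    · push Not at h
      rw [List.getD_append_right _ _ _ _ h, ih _ (by rw [Nat.add_mul] at hi; omega),
        Nat.mod_eq_sub_mod h]

/-- This is what lets a period be replaced by a shorter one: `block (n + 1)` by D, `D ++ [1]` by `B
++ [1]`, and B by C. -/
lemma per_flatten_replicate (L : List (Fin 2)) {m : ℕ} (hm : 1 ≤ m) :
    per (List.replicate m L).flatten = per L := by
  funext t
  rcases Nat.eq_zero_or_pos L.length with h0 | h0
  · have : L = [] := List.eq_nil_of_length_eq_zero h0
    subst this
    simp [per]
  have hlen : (List.replicate m L).flatten.length = m * L.length := by simp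
  have hpos : 0 < m * L.length := by positivity
  unfold per
  rw [hlen]
  have h1 := Int.emod_nonneg t (b := ((m * L.length : ℕ) : ℤ)) (by omega)
  have h2 := Int.emod_lt_of_pos t (b := ((m * L.length : ℕ) : ℤ)) (by omega)
  rw [getD_flatten_replicate _ _ _ (by omega)]
  congr 1
  zify
  rw [← Nat.cast_mul, Int.toNat_of_nonneg h1, Int.toNat_of_nonneg (Int.emod_nonneg _ (by omega))]
  rw [Int.emod_emod_of_dvd]
  exact ⟨m, by push_cast; ring⟩

lemma wordAt_congr {A : Type*} {x y : ℤ → A} {i j : ℤ} {q : ℕ}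
    (h : ∀ t : ℤ, 0 ≤ t → t < q → x (i + t) = y (j + t)) : wordAt x i q = wordAt y j q := by
  unfold wordAt
  congr 1
  funext t
  exact h t (by positivity) (by exact_mod_cast t.2)

lemma length_wordAt {A : Type*} (x : ℤ → A) (i : ℤ) (q : ℕ) : (wordAt x i q).length = q := by
  simp [wordAt]

lemma wordAt_per_emod (L : List (Fin 2)) (i : ℤ) (q : ℕ) :
    wordAt (per L) i q = wordAt (per L) (i % L.length) q :=
  wordAt_congr fun t _ _ => per_congr L (by simp)

lemma exists_wordAt_of_infix {w L : List (Fin 2)} (hw : w <:+: L) {Z : ℤ → Fin 2} {a : ℤ}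
    (hZ : ∀ t : ℕ, t < L.length → Z (a + t) = L.getD t 0) :
    ∃ i : ℤ, w = wordAt Z i w.length := by
  obtain ⟨u, v, rfl⟩ := hw
  refine ⟨a + u.length, ?_⟩
  apply List.ext_getElem
  · simp [wordAt]
  intro t h1 h2
  have := hZ (u.length + t) (by simp; omega)
  simp only [wordAt, List.getElem_ofFn]
  rw [show a + (u.length : ℤ) + (t : ℤ) = a + ((u.length + t : ℕ) : ℤ) by push_cast; ring, this]
  rw [List.append_assoc, List.getD_append_right _ _ _ _ (by omega), Nat.add_sub_cancel_left,
    List.getD_append _ _ _ _ h1, List.getD_eq_getElem _ _ h1]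

lemma exists_wordAt_per {w L : List (Fin 2)} (hw : w <:+: L ++ L) :
    ∃ i : ℤ, w = wordAt (per L) i w.length := by
  refine exists_wordAt_of_infix hw (a := 0) fun t ht => ?_
  rw [zero_add]
  have := per_flatten_replicate L (m := 2) (by omega)
  rw [← this, show (List.replicate 2 L).flatten = L ++ L by simp [List.replicate], per_of_lt ht]

lemma exists_wordAt_ins {w L : List (Fin 2)} (hw : w <:+: L ++ 1 :: L) :
    ∃ i : ℤ, w = wordAt (ins L) i w.length := by
  refine exists_wordAt_of_infix hw (a := -L.length) fun t ht => ?_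
  simp only [List.length_append, List.length_cons] at ht
  rcases lt_trichotomy t L.length with h | h | h
  · rw [List.getD_append _ _ _ _ h, ← per_of_lt h, ins, if_pos (by omega)]
    exact per_congr L (by simp)
  · subst h
    simp [ins]
  · rw [List.getD_append_right _ _ _ _ h.le, ins, if_neg (by omega), if_neg (by omega)]
    obtain ⟨s, rfl⟩ : ∃ s, t = L.length + s + 1 := ⟨t - L.length - 1, by omega⟩
    rw [show L.length + s + 1 - L.length = s + 1 by omega, List.getD_cons_succ,
      ← per_of_lt (by omega)]
    apply per_congr
    congr 1
    push_cast
    ring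

/-! ### Counting words -/

lemma complexity_le_card {A : Type*} {X : Set (ℤ → A)} {q : ℕ} (S : Finset (List A))
    (h : ∀ w ∈ language X, w.length = q → w ∈ S) : complexity X q ≤ S.card := by
  rw [complexity, ← Set.ncard_coe_finset]
  exact Set.ncard_le_ncard (fun w hw => h w hw.1 hw.2) S.finite_toSet

/-- The windows of length `q` of `Z` starting at positions in `[a, b)`. -/
noncomputable def windows (Z : ℤ → Fin 2) (q : ℕ) (a b : ℤ) : Finset (List (Fin 2)) :=
  (Finset.Ico a b).image fun i => wordAt Z i q

lemma card_windows_le (Z : ℤ → Fin 2) (q : ℕ) (a b : ℤ) :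
    (windows Z q a b).card ≤ (b - a).toNat :=
  Finset.card_image_le.trans (by simp)

lemma mem_windows {Z : ℤ → Fin 2} {q : ℕ} {a b i : ℤ} (h1 : a ≤ i) (h2 : i < b) :
    wordAt Z i q ∈ windows Z q a b :=
  Finset.mem_image_of_mem _ (Finset.mem_Ico.2 ⟨h1, h2⟩)

lemma mem_windows_per {L : List (Fin 2)} (hL : L ≠ []) (i : ℤ) (q : ℕ) :
    wordAt (per L) i q ∈ windows (per L) q 0 L.length := by
  have : 0 < L.length := List.length_pos_iff.2 hL
  rw [wordAt_per_emod]
  exact mem_windows (Int.emod_nonneg _ (by omega)) (Int.emod_lt_of_pos _ (by omega))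

/-- Either the window of `ins L` is a window of `per L`, or it contains the inserted `1`. -/
lemma wordAt_ins_cases (L : List (Fin 2)) (i : ℤ) (q : ℕ) :
    (∃ j, wordAt (ins L) i q = wordAt (per L) j q) ∨ (-q < i ∧ i ≤ 0) := by
  by_cases h1 : 0 < i
  · refine .inl ⟨i - 1, wordAt_congr fun t ht _ => ?_⟩
    rw [ins, if_neg (by omega), if_neg (by omega)]
    congr 1; ring
  by_cases h2 : i + q ≤ 0
  · refine .inl ⟨i, wordAt_congr fun t ht _ => ?_⟩
    rw [ins, if_pos (by omega)]
  exact .inr ⟨by omega, by omega⟩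

/-- The defect is the gap between positions -1 and 0, not a letter, so only q - 1 windows see it,
against q for `ins`. -/
lemma wordAt_jun_cases (L : List (Fin 2)) (i : ℤ) (q : ℕ) :
    (∃ j, wordAt (jun L) i q = wordAt (per (L ++ [1])) j q) ∨ (-q < i ∧ i < 0) := by
  by_cases h1 : 0 ≤ i
  · refine .inl ⟨i, wordAt_congr fun t ht _ => ?_⟩
    rw [jun, if_neg (by omega)]
  by_cases h2 : i + q ≤ 0
  · refine .inl ⟨i - 1, wordAt_congr fun t ht _ => ?_⟩
    rw [jun, if_pos (by omega)]
    congr 1; ring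
  exact .inr ⟨by omega, by omega⟩

/-- All words of length `q` of `X` occur in `⋯DDD⋯` or in `⋯DD1DD⋯`. -/
def NearPeriodic (X : Set (ℤ → Fin 2)) (D : List (Fin 2)) (q : ℕ) : Prop :=
  ∀ w ∈ language X, w.length = q → ∃ i, w = wordAt (per D) i q ∨ w = wordAt (ins D) i q

section Count

variable {X : Set (ℤ → Fin 2)} {B C D : List (Fin 2)} {q P K : ℕ}

lemma NearPeriodic.complexity_le (hX : NearPeriodic X D q) (hD : D ≠ []) :
    complexity X q ≤ q + D.length := by
  refine (complexity_le_card (windows (per D) q 0 D.length ∪ windows (ins D) q (1 - q) 1)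
    fun w hw hq => ?_).trans ((Finset.card_union_le _ _).trans ?_)
  · rw [Finset.mem_union]
    obtain ⟨i, rfl | rfl⟩ := hX w hw hq
    · exact .inl (mem_windows_per hD i q)
    rcases wordAt_ins_cases D i q with ⟨j, hj⟩ | ⟨h1, h2⟩
    · exact .inl (hj ▸ mem_windows_per hD j q)
    · exact .inr (mem_windows (by omega) (by omega))
  · have h1 := card_windows_le (per D) q 0 D.length
    have h2 := card_windows_le (ins D) q (1 - q) 1
    omega

lemma per_eq_of_append_one (hP : 1 ≤ P) (hD : D ++ [1] = (List.replicate P (B ++ [1])).flatten) :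
    per (D ++ [1]) = per (B ++ [1]) := by
  rw [hD, per_flatten_replicate _ hP]

lemma per_eq_per_append_one {t : ℤ} (h0 : 0 ≤ t) (h1 : t < D.length) :
    per D t = per (D ++ [1]) t := by
  lift t to ℕ using h0
  rw [per_of_lt (by omega), per_of_lt (by simp; omega), List.getD_append _ _ _ _ (by omega)]

/-- Around the defect, `⋯DD1DD⋯` agrees with a periodic sequence. -/
lemma ins_eq_per {t : ℤ} (h0 : -D.length ≤ t) (h1 : t ≤ D.length) :
    ins D t = per (D ++ [1]) (t + D.length) := by
  rcases lt_trichotomy t 0 with h | h | h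
  · rw [ins, if_pos h, ← per_eq_per_append_one (by omega) (by omega)]
    exact per_congr D (by simp)
  · subst h
    rw [zero_add, per_of_lt (by simp)]
    simp [ins]
  · rw [ins, if_neg (by omega), if_neg (by omega), per_eq_per_append_one (by omega) (by omega)]
    exact (per_append_one_of_eq_add (by ring)).symm

lemma wordAt_ins_eq_per {i : ℤ} (h0 : -D.length ≤ i) (h1 : i + q ≤ D.length + 1) :
    wordAt (ins D) i q = wordAt (per (D ++ [1])) (i + D.length) q :=
  wordAt_congr fun t ht hq => by
    rw [ins_eq_per (by omega) (by omega)]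
    congr 1; ring

/-- The stretch D1D around the inserted 1 is a piece of ⋯B1B1⋯, so the windows through that 1 that
stay inside it are among only |B| + 1 words. Of the others, q - |D| - 1 start before the stretch and
q - |D| - 1 end after it. -/
lemma NearPeriodic.complexity_le_of_gt (hX : NearPeriodic X D q) (hD' : D ≠ []) (hP : 1 ≤ P)
    (hD : D ++ [1] = (List.replicate P (B ++ [1])).flatten) (hq : D.length < q) :
    complexity X q + D.length + 1 ≤ 2 * q + B.length := by
  have key : complexity X q ≤ (windows (per D) q 0 D.length ∪
      (windows (per (B ++ [1])) q 0 (B ++ [1]).length ∪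
        (windows (ins D) q (1 - q) (-D.length) ∪
          windows (ins D) q (D.length + 2 - q) 1))).card := by
    refine complexity_le_card _ fun w hw hq => ?_
    simp only [Finset.mem_union]
    obtain ⟨i, rfl | rfl⟩ := hX w hw hq
    · exact .inl (mem_windows_per hD' i q)
    rcases wordAt_ins_cases D i q with ⟨j, hj⟩ | ⟨h1, h2⟩
    · exact .inl (hj ▸ mem_windows_per hD' j q)
    right
    by_cases h3 : i < -D.length
    · exact .inr (.inl (mem_windows (by omega) (by omega)))
    by_cases h4 : D.length + 1 < i + q
    · exact .inr (.inr (mem_windows (by omega) (by omega)))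
    · left
      rw [wordAt_ins_eq_per (by omega) (by omega), per_eq_of_append_one hP hD]
      exact mem_windows_per (by simp) _ _
  have h0 := card_windows_le (per D) q 0 D.length
  have h1 := card_windows_le (per (B ++ [1])) q 0 (B ++ [1]).length
  have h2 := card_windows_le (ins D) q (1 - q) (-D.length)
  have h3 := card_windows_le (ins D) q (D.length + 2 - q) 1
  have := key.trans ((Finset.card_union_le _ _).trans (Nat.add_le_add_left
    ((Finset.card_union_le _ _).trans (Nat.add_le_add_left (Finset.card_union_le _ _) _)) _))
  simp only [List.length_append, List.length_singleton] at h1 this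
  omega

/-- Windows that are not longer than `D = B1B1⋯1B` see at most one pair of adjacent copies
of `B`. -/
lemma NearPeriodic.exists_jun (hX : NearPeriodic X D q) (hD' : D ≠ []) (hP : 1 ≤ P)
    (hD : D ++ [1] = (List.replicate P (B ++ [1])).flatten) (hq : q ≤ D.length)
    {w : List (Fin 2)} (hw : w ∈ language X) (hwq : w.length = q) :
    (∃ i, w = wordAt (per (B ++ [1])) i q) ∨ ∃ i, w = wordAt (jun B) i q := by
  have hper := per_eq_of_append_one hP hD
  have hpos : 0 < D.length := List.length_pos_iff.2 hD'
  -- After reducing the start mod |D|, the window meets at most one junction of two copies of D, as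
  -- q ≤ |D|. Translating by |D| puts that junction at 0.
  have main : ∀ i, ∃ i', wordAt (per D) i q = wordAt (jun B) i' q := by
    intro i
    have h1 := Int.emod_nonneg i (b := (D.length : ℤ)) (by omega)
    have h2 := Int.emod_lt_of_pos i (b := (D.length : ℤ)) (by omega)
    rw [wordAt_per_emod]
    set j := i % (D.length : ℤ)
    refine ⟨j - D.length, wordAt_congr fun t ht htq => ?_⟩
    by_cases h : j + t < D.length
    · rw [per_eq_per_append_one (by omega) h, jun, if_pos (by omega), ← hper]
      exact per_append_one_of_eq_add (by ring)
    · rw [jun, if_neg (by omega), ← hper, ← per_eq_per_append_one (by omega) (by omega)]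
      exact per_of_eq_add (by ring)
  obtain ⟨i, rfl | rfl⟩ := hX w hw hwq
  · exact .inr (main i)
  rcases wordAt_ins_cases D i q with ⟨j, hj⟩ | ⟨h1, h2⟩
  · exact .inr (hj ▸ main j)
  -- A window through the inserted 1 with q ≤ |D| cannot leave D1D.
  · rw [wordAt_ins_eq_per (by omega) (by omega), hper]
    exact .inl ⟨_, rfl⟩

lemma NearPeriodic.complexity_le_of_le (hX : NearPeriodic X D q) (hD' : D ≠ []) (hP : 1 ≤ P)
    (hD : D ++ [1] = (List.replicate P (B ++ [1])).flatten) (hq : q ≤ D.length) (hq1 : 1 ≤ q) :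
    complexity X q ≤ q + B.length := by
  refine (complexity_le_card (windows (per (B ++ [1])) q 0 (B ++ [1]).length ∪
    windows (jun B) q (1 - q) 0) fun w hw hwq => ?_).trans ((Finset.card_union_le _ _).trans ?_)
  · rw [Finset.mem_union]
    rcases hX.exists_jun hD' hP hD hq hw hwq with ⟨i, rfl⟩ | ⟨i, rfl⟩
    · exact .inl (mem_windows_per (by simp) i q)
    rcases wordAt_jun_cases B i q with ⟨j, hj⟩ | ⟨h1, h2⟩
    · exact .inl (hj ▸ mem_windows_per (by simp) j q)
    · exact .inr (mem_windows (by omega) (by omega))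
  · have h1 := card_windows_le (per (B ++ [1])) q 0 (B ++ [1]).length
    have h2 := card_windows_le (jun B) q (1 - q) 0
    simp only [List.length_append, List.length_singleton] at *
    omega

/-- The two adjacent copies of `B` in `jun B` form a piece of a periodic sequence. -/
lemma jun_eq_per {t : ℤ} (h0 : -B.length ≤ t) (h1 : t < B.length) : jun B t = per B t := by
  by_cases h : t < 0
  · rw [jun, if_pos h]
    have h2 := per_eq_per_append_one (D := B) (t := t + B.length) (by omega) (by omega)
    rw [show per B t = per B (t + B.length) from (per_of_eq_add rfl).symm, h2]
    exact (per_append_one_of_eq_add (by ring)).symm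
  · rw [jun, if_neg h, per_eq_per_append_one (D := B) (by omega) (by omega)]

/-- The same saving one scale down: windows of `jun B` across the junction that stay inside BB lie
in ⋯CCC⋯, so they contribute at most |C| words. On each side q - |B| - 1 windows stick out. -/
lemma NearPeriodic.complexity_le_of_le_of_gt (hX : NearPeriodic X D q) (hD' : D ≠ [])
    (hP : 1 ≤ P) (hD : D ++ [1] = (List.replicate P (B ++ [1])).flatten) (hq : q ≤ D.length)
    (hC : C ≠ []) (hK : 1 ≤ K) (hB : B = (List.replicate K C).flatten) (hBq : B.length < q) :
    complexity X q + B.length + 1 ≤ 2 * q + C.length := by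
  have key : complexity X q ≤ (windows (per C) q 0 C.length ∪
      (windows (per (B ++ [1])) q 0 (B ++ [1]).length ∪
        (windows (jun B) q (1 - q) (-B.length) ∪
          windows (jun B) q (B.length + 1 - q) 0))).card := by
    refine complexity_le_card _ fun w hw hwq => ?_
    simp only [Finset.mem_union]
    rcases hX.exists_jun hD' hP hD hq hw hwq with ⟨i, rfl⟩ | ⟨i, rfl⟩
    · exact .inr (.inl (mem_windows_per (by simp) i q))
    rcases wordAt_jun_cases B i q with ⟨j, hj⟩ | ⟨h1, h2⟩
    · exact .inr (.inl (hj ▸ mem_windows_per (by simp) j q))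
    by_cases h3 : i < -B.length
    · exact .inr (.inr (.inl (mem_windows (by omega) (by omega))))
    by_cases h4 : B.length < i + q
    · exact .inr (.inr (.inr (mem_windows (by omega) (by omega))))
    · left
      rw [show wordAt (jun B) i q = wordAt (per C) i q from wordAt_congr fun t _ _ => by
        rw [jun_eq_per (by omega) (by omega), hB, per_flatten_replicate C hK]]
      exact mem_windows_per hC _ _
  have h0 := card_windows_le (per C) q 0 C.length
  have h1 := card_windows_le (per (B ++ [1])) q 0 (B ++ [1]).length
  have h2 := card_windows_le (jun B) q (1 - q) (-B.length)
  have h3 := card_windows_le (jun B) q (B.length + 1 - q) 0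
  have := key.trans ((Finset.card_union_le _ _).trans (Nat.add_le_add_left
    ((Finset.card_union_le _ _).trans (Nat.add_le_add_left (Finset.card_union_le _ _) _)) _))
  simp only [List.length_append, List.length_singleton] at h1 this
  omega

end Count

/-! ### Concatenations of a word with sparse spacers -/

/-- Concatenations of copies of `B` in which consecutive copies are separated by nothing
or by a `1`. -/
inductive Stacked (B : List (Fin 2)) : List (Fin 2) → Prop
  | base : Stacked B B
  | adj {L : List (Fin 2)} : Stacked B L → Stacked B (B ++ L)
  | spaced {L : List (Fin 2)} : Stacked B L → Stacked B (B ++ 1 :: L)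

namespace Stacked

variable {B L M : List (Fin 2)}

lemma append (hL : Stacked B L) (hM : Stacked B M) : Stacked B (L ++ M) := by
  induction hL with
  | base => exact .adj hM
  | adj _ ih => rw [List.append_assoc]; exact .adj ih
  | spaced _ ih => rw [List.append_assoc, List.cons_append]; exact .spaced ih

lemma append_one (hL : Stacked B L) (hM : Stacked B M) : Stacked B (L ++ 1 :: M) := by
  induction hL with
  | base => exact .spaced hM
  | adj _ ih => rw [List.append_assoc]; exact .adj ih
  | spaced _ ih => rw [List.append_assoc, List.cons_append]; exact .spaced ih

lemma prefix_of_length_le (hL : Stacked B L) {w : List (Fin 2)} (hw : w <+: L)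
    (h : w.length ≤ B.length) : w <+: B := by
  have hB : B <+: L := by
    cases hL with
    | base => exact List.prefix_rfl
    | adj _ => exact List.prefix_append _ _
    | spaced _ => exact List.prefix_append _ _
  exact List.prefix_of_prefix_length_le hw hB h

/-- A word not longer than B cannot contain a whole copy of B together with letters on both sides,
so two neighbouring copies suffice. If w straddles the end of the first copy, its overhang is a
prefix of the next copy. -/
lemma infix_of_length_le (hL : Stacked B L) {w : List (Fin 2)} (hw : w <:+: L)
    (h : w.length ≤ B.length) : w <:+: B ++ B ∨ w <:+: B ++ 1 :: B := by
  induction hL with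
  | base => exact .inl (List.infix_append_of_infix_left hw)
  | adj hL ih =>
    rcases List.infix_append_iff.1 hw with h1 | h1 | ⟨u, v, rfl, hu, hv⟩
    · exact .inl (List.infix_append_of_infix_left h1)
    · exact ih h1
    · left
      rw [List.infix_append_iff]
      exact .inr (.inr ⟨u, v, rfl, hu, hL.prefix_of_length_le hv (by simp at h; omega)⟩)
  | @spaced L hL ih =>
    rcases List.infix_append_iff.1 hw with h1 | h1 | ⟨u, v, rfl, hu, hv⟩
    · exact .inl (List.infix_append_of_infix_left h1)
    · rcases List.infix_cons_iff.1 h1 with h1 | h1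
      · right
        apply List.infix_append_of_infix_right
        cases w with
        | nil => exact List.nil_infix
        | cons a w =>
          rw [List.cons_prefix_cons] at h1
          exact (List.cons_prefix_cons.2 ⟨h1.1, hL.prefix_of_length_le h1.2
            (by simp at h; omega)⟩).isInfix
      · exact ih h1
    · right
      rw [List.infix_append_iff]
      refine .inr (.inr ⟨u, v, rfl, hu, ?_⟩)
      cases v with
      | nil => exact List.nil_prefix
      | cons a v =>
        rw [List.cons_prefix_cons] at hv
        exact List.cons_prefix_cons.2 ⟨hv.1, hL.prefix_of_length_le hv.2
            (by simp at h; omega)⟩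

/-- The last copy of L is kept apart because a stacked word must not end with a spacer. -/
lemma flatMap (hL : Stacked B L) (s : ℕ → ℕ) (hs : ∀ i, s i ≤ 1) (m : ℕ) :
    Stacked B ((List.range m).flatMap (fun i => L ++ List.replicate (s i) 1) ++ L) := by
  induction m with
  | zero => simpa
  | succ m ih =>
    rw [List.range_succ, List.flatMap_append, List.flatMap_singleton, List.append_assoc,
      List.append_assoc, ← List.append_assoc]
    rcases Nat.le_one_iff_eq_zero_or_eq_one.1 (hs m) with h | h
    · rw [h]
      exact ih.append hL
    · rw [h]
      exact ih.append_one hL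

end Stacked

end RankOne

/-! ### Indexing concatenations -/

lemma length_flatMap_range {α : Type*} (g : ℕ → List α) (N : ℕ) :
    ((List.range N).flatMap g).length = ∑ i ∈ Finset.range N, (g i).length := by
  induction N with
  | zero => simp
  | succ N ih =>
    rw [List.range_succ, List.flatMap_append, List.flatMap_singleton, List.length_append, ih,
      Finset.sum_range_succ]

lemma getD_flatMap_range {α : Type*} (g : ℕ → List α) (a : α) {N i j : ℕ} (hi : i < N)
    (hj : j < (g i).length) :
    ((List.range N).flatMap g).getD (∑ i' ∈ Finset.range i, (g i').length + j) a =
      (g i).getD j a := by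
  induction N with
  | zero => omega
  | succ N ih =>
    rw [List.range_succ, List.flatMap_append, List.flatMap_singleton]
    rcases Nat.lt_succ_iff_lt_or_eq.1 hi with h | rfl
    · rw [List.getD_append, ih h]
      rw [length_flatMap_range]
      calc _ < ∑ i' ∈ Finset.range (i + 1), (g i').length := by
            rw [Finset.sum_range_succ]; omega
        _ ≤ _ := Finset.sum_le_sum_of_subset (Finset.range_subset_range.2 h)
    · rw [List.getD_append_right _ _ _ _ (by rw [length_flatMap_range]; omega),
        length_flatMap_range, Nat.add_sub_cancel_left]

lemma exists_eq_sum_range_add (g : ℕ → ℕ) {N t : ℕ} (ht : t < ∑ i ∈ Finset.range N, g i) :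
    ∃ i < N, ∃ j < g i, t = ∑ i' ∈ Finset.range i, g i' + j := by
  induction N with
  | zero => simp at ht
  | succ N ih =>
    by_cases h : t < ∑ i ∈ Finset.range N, g i
    · obtain ⟨i, hi, j, hj, e⟩ := ih h
      exact ⟨i, by omega, j, hj, e⟩
    · rw [Finset.sum_range_succ] at ht
      exact ⟨N, by omega, t - ∑ i ∈ Finset.range N, g i, by omega, by omega⟩

namespace RankOne

variable (T : RankOne) {n j : ℕ}

/-! ### The levels of the columns -/

/-- The height in column `n + 1` of the bottom level of the `i`-th subcolumn of column `n`. -/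
def offset (n i : ℕ) : ℕ := ∑ i' ∈ Finset.range i, (T.height n + T.s n i')

lemma offset_succ (n i : ℕ) : T.offset n (i + 1) = T.offset n i + (T.height n + T.s n i) :=
  Finset.sum_range_succ _ _

lemma offset_mono (n : ℕ) : Monotone (T.offset n) :=
  monotone_nat_of_le_succ fun i => by rw [offset_succ]; omega

lemma width_pos (n : ℕ) : 0 < T.width n :=
  one_div_pos.2 (Finset.prod_pos fun _ _ => by positivity)

lemma width_eq (hn : 1 ≤ n) : T.width n = (T.r n + 1) * T.width (n + 1) := by
  have : (0 : ℝ) < ∏ j ∈ Finset.Ico 1 n, ((T.r j : ℝ) + 1) :=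
    Finset.prod_pos fun _ _ => by positivity
  rw [width, width, Finset.prod_Ico_succ_top hn]
  field_simp

lemma height_succ (hn : 1 ≤ n) : T.height (n + 1) = T.offset n (T.r n + 1) := by
  obtain ⟨n, rfl⟩ := Nat.exists_eq_add_of_le' hn
  rw [height, block, length_flatMap_range, offset]
  simp [height]

lemma height_succ' (hn : 1 ≤ n) :
    T.height (n + 1) = (T.r n + 1) * T.height n + ∑ i ∈ Finset.range (T.r n + 1), T.s n i := by
  rw [height_succ T hn, offset, Finset.sum_add_distrib]
  simp

lemma height_pos (hn : 1 ≤ n) : 0 < T.height n := by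
  induction n, hn using Nat.le_induction with
  | base => simp [height, block]
  | succ n hn ih =>
    rw [height_succ' T hn]
    positivity

lemma length_lefts (n : ℕ) : (T.lefts n).length = T.height n := by
  induction n with
  | zero => simp [lefts, height, block]
  | succ n ih =>
    rcases n with _ | n
    · simp [lefts, height, block]
    · rw [height_succ T (by omega), lefts, length_flatMap_range, offset]
      simp [ih]

lemma offset_add_lt {i : ℕ} (hn : 1 ≤ n) (hi : i ≤ T.r n) (hj : j < T.height n) :
    T.offset n i + j < T.height (n + 1) := by
  rw [height_succ T hn]
  calc _ < T.offset n (i + 1) := by rw [offset_succ]; omega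
    _ ≤ _ := T.offset_mono n (by omega)

lemma left_offset_add {i : ℕ} (hn : 1 ≤ n) (hi : i ≤ T.r n) (hj : j < T.height n) :
    T.left (n + 1) (T.offset n i + j) = T.left n j + i * T.width (n + 1) := by
  obtain ⟨n, rfl⟩ := Nat.exists_eq_add_of_le' hn
  have hj' : j < (T.lefts (n + 1)).length := by rwa [length_lefts]
  rw [left, lefts]
  have := getD_flatMap_range (N := T.r (n + 1) + 1) (i := i) (j := j)
    (fun i : ℕ => (T.lefts (n + 1)).map (fun a : ℝ => a + (i : ℝ) * T.width (n + 2)) ++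
      (List.range (T.s (n + 1) i)).map fun k : ℕ =>
        T.height (n + 1) * T.width (n + 1) +
          (((∑ i' ∈ Finset.range i, T.s (n + 1) i' : ℕ) : ℝ) + (k : ℝ)) * T.width (n + 2))
    0 (by omega) (by simp; omega)
  simp only [List.length_append, List.length_map, length_lefts, List.length_range] at this
  rw [offset, this, List.getD_append _ _ _ _ (by simpa using hj'), left,
    List.getD_eq_getElem _ _ (by simpa using hj'), List.getElem_map, List.getD_eq_getElem]

lemma left_spacer {i k : ℕ} (hn : 1 ≤ n) (hi : i ≤ T.r n) (hk : k < T.s n i) :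
    T.left (n + 1) (T.offset n i + (T.height n + k)) = T.height n * T.width n +
      (((∑ i' ∈ Finset.range i, T.s n i' : ℕ) : ℝ) + (k : ℝ)) * T.width (n + 1) := by
  obtain ⟨n, rfl⟩ := Nat.exists_eq_add_of_le' hn
  rw [left, lefts]
  have := getD_flatMap_range (N := T.r (n + 1) + 1) (i := i) (j := T.height (n + 1) + k)
    (fun i : ℕ => (T.lefts (n + 1)).map (fun a : ℝ => a + (i : ℝ) * T.width (n + 2)) ++
      (List.range (T.s (n + 1) i)).map fun k : ℕ =>
        T.height (n + 1) * T.width (n + 1) +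
          (((∑ i' ∈ Finset.range i, T.s (n + 1) i' : ℕ) : ℝ) + (k : ℝ)) * T.width (n + 2))
    0 (by omega) (by simp [length_lefts]; omega)
  simp only [List.length_append, List.length_map, length_lefts, List.length_range] at this
  rw [offset, this, List.getD_append_right _ _ _ _ (by simp [length_lefts]),
    List.getD_eq_getElem _ _ (by simp [length_lefts]; omega), List.getElem_map]
  simp [length_lefts]

lemma block_offset_add {i : ℕ} (hn : 1 ≤ n) (hi : i ≤ T.r n) (hj : j < T.height n) :
    (T.block (n + 1)).getD (T.offset n i + j) 0 = (T.block n).getD j 0 := by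
  obtain ⟨n, rfl⟩ := Nat.exists_eq_add_of_le' hn
  rw [block]
  have := getD_flatMap_range (N := T.r (n + 1) + 1) (i := i) (j := j)
    (fun i : ℕ => T.block (n + 1) ++ List.replicate (T.s (n + 1) i) 1)
    0 (by omega) (by rw [height] at hj; simp; omega)
  simp only [List.length_append, List.length_replicate] at this
  rw [offset]
  simp only [height]
  rw [this, List.getD_append _ _ _ _ hj]

/-- Cell m of the finer grid is piece m % (r + 1) of the old cell m / (r + 1) as long as m lies in
the old column. The cells after it are the spacers, in the order in which they are placed. -/
lemma exists_left_eq (hn : 1 ≤ n) {m : ℕ} (hm : m < T.height n) :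
    ∃ j < T.height n, T.left n j = m * T.width n := by
  induction n, hn using Nat.le_induction generalizing m with
  | base =>
    have : m = 0 := by simp [height, block] at hm; omega
    exact ⟨0, by simp [height, block], by simp [left, lefts, this]⟩
  | succ n hn ih =>
    by_cases h : m < (T.r n + 1) * T.height n
    · obtain ⟨j, hj, e⟩ := ih (m := m / (T.r n + 1)) (Nat.div_lt_of_lt_mul h)
      have hi : m % (T.r n + 1) ≤ T.r n := Nat.lt_succ_iff.1 (Nat.mod_lt _ (by omega))
      refine ⟨T.offset n (m % (T.r n + 1)) + j, T.offset_add_lt hn hi hj, ?_⟩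
      rw [left_offset_add T hn hi hj, e, width_eq T hn]
      have := Nat.div_add_mod m (T.r n + 1)
      conv_rhs => rw [← this]
      push_cast
      ring
    · push Not at h
      obtain ⟨e, rfl⟩ := Nat.exists_eq_add_of_le h
      rw [height_succ' T hn] at hm
      obtain ⟨i, hi, k, hk, rfl⟩ := exists_eq_sum_range_add (T.s n) (N := T.r n + 1) (t := e)
        (by omega)
      refine ⟨T.offset n i + (T.height n + k), ?_, ?_⟩
      · rw [height_succ T hn]
        calc _ < T.offset n (i + 1) := by rw [offset_succ]; omega
          _ ≤ _ := T.offset_mono n (by omega)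
      · rw [left_spacer T hn (by omega) hk, width_eq T hn]
        push_cast
        ring

/-- The levels of column `n` are the intervals `[m * width n, (m + 1) * width n)`, permuted. -/
lemma exists_perm (hn : 1 ≤ n) : ∃ e : Equiv.Perm (Fin (T.height n)),
    ∀ j : Fin (T.height n), T.left n j = (e j : ℕ) * T.width n := by
  choose g hg hg' using fun m : Fin (T.height n) => T.exists_left_eq hn m.2
  let G : Fin (T.height n) → Fin (T.height n) := fun m => ⟨g m, hg m⟩
  have hG : Function.Injective G := by
    intro m m' h
    have h1 := hg' m
    rw [show g m = g m' from congrArg Fin.val h, hg' m'] at h1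
    have := mul_right_cancel₀ (T.width_pos n).ne' h1
    exact Fin.ext (by exact_mod_cast this.symm)
  refine ⟨(Equiv.ofBijective G (Finite.injective_iff_bijective.1 hG)).symm, fun j => ?_⟩
  rw [← hg']
  congr 1
  exact congrArg Fin.val (Equiv.ofBijective_apply_symm_apply G _ j).symm

lemma measurableSet_level (n j : ℕ) : MeasurableSet (T.level n j) := measurableSet_Ico

lemma volume_level (n j : ℕ) : volume (T.level n j) = ENNReal.ofReal (T.width n) := by
  simp [level]

lemma eq_of_mem_level (hn : 1 ≤ n) {j' : ℕ} (hj : j < T.height n) (hj' : j' < T.height n) {x : ℝ}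
    (hx : x ∈ T.level n j) (hx' : x ∈ T.level n j') : j = j' := by
  obtain ⟨e, he⟩ := T.exists_perm hn
  have h1 := he ⟨j, hj⟩
  have h2 := he ⟨j', hj'⟩
  simp only at h1 h2
  rw [level, h1, mem_Ico] at hx
  rw [level, h2, mem_Ico] at hx'
  have hw := T.width_pos n
  have e1 : ((e ⟨j, hj⟩ : ℕ) : ℝ) < (e ⟨j', hj'⟩ : ℕ) + 1 := by
    by_contra! h
    nlinarith [mul_le_mul_of_nonneg_right h hw.le]
  have e2 : ((e ⟨j', hj'⟩ : ℕ) : ℝ) < (e ⟨j, hj⟩ : ℕ) + 1 := by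
    by_contra! h
    nlinarith [mul_le_mul_of_nonneg_right h hw.le]
  have : e ⟨j, hj⟩ = e ⟨j', hj'⟩ := by
    ext
    have e1' : (e ⟨j, hj⟩ : ℕ) < (e ⟨j', hj'⟩ : ℕ) + 1 := by exact_mod_cast e1
    have e2' : (e ⟨j', hj'⟩ : ℕ) < (e ⟨j, hj⟩ : ℕ) + 1 := by exact_mod_cast e2
    omega
  simpa using e.injective this

/-- The union of the levels of column `n`. -/
def column (n : ℕ) : Set ℝ := Ico 0 (T.height n * T.width n)

lemma mem_column_iff (hn : 1 ≤ n) {x : ℝ} :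
    x ∈ T.column n ↔ ∃ j < T.height n, x ∈ T.level n j := by
  obtain ⟨e, he⟩ := T.exists_perm hn
  have hw := T.width_pos n
  constructor
  · rintro ⟨h0, h1⟩
    have hm : ⌊x / T.width n⌋₊ < T.height n := by
      rw [Nat.floor_lt (by positivity), div_lt_iff₀ hw]
      exact h1
    refine ⟨e.symm ⟨_, hm⟩, Fin.is_lt _, ?_⟩
    rw [level, he, Equiv.apply_symm_apply, mem_Ico]
    have h2 := Nat.floor_le (a := x / T.width n) (by positivity)
    have h3 := Nat.lt_floor_add_one (x / T.width n)
    rw [le_div_iff₀ hw] at h2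
    rw [div_lt_iff₀ hw] at h3
    exact ⟨h2, by simp only; linarith⟩
  · rintro ⟨j, hj, hx⟩
    rw [level, he ⟨j, hj⟩, mem_Ico] at hx
    refine ⟨le_trans (by positivity) hx.1, hx.2.trans_le ?_⟩
    have : ((e ⟨j, hj⟩ : ℕ) : ℝ) + 1 ≤ T.height n := by exact_mod_cast (e ⟨j, hj⟩).2
    nlinarith

lemma volume_column (n : ℕ) : volume (T.column n) = ENNReal.ofReal (T.height n * T.width n) := by
  simp [column]

lemma pairwiseDisjoint_level (hn : 1 ≤ n) :
    (Finset.range (T.height n) : Set ℕ).PairwiseDisjoint (T.level n) := by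
  intro j hj j' hj' hne
  rw [Function.onFun, Set.disjoint_left]
  intro x hx hx'
  exact hne (T.eq_of_mem_level hn (by simpa using hj) (by simpa using hj') hx hx')

lemma space_eq : T.space = ⋃ n ≥ 1, T.column n := by
  ext x
  simp only [space, mem_iUnion, exists_prop]
  constructor
  · rintro ⟨n, j, hj, hx⟩
    have hn : 1 ≤ n := by
      by_contra h
      have : n = 0 := by omega
      subst this
      simp [height, block] at hj
    exact ⟨n, hn, (T.mem_column_iff hn).2 ⟨j, hj, hx⟩⟩
  · rintro ⟨n, hn, hx⟩
    obtain ⟨j, hj, hx⟩ := (T.mem_column_iff hn).1 hx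
    exact ⟨n, j, hj, hx⟩

/-! ### Passing to later columns -/

lemma level_offset_subset {i : ℕ} (hn : 1 ≤ n) (hi : i ≤ T.r n) (hj : j < T.height n) :
    T.level (n + 1) (T.offset n i + j) ⊆ T.level n j := by
  have hw := T.width_pos (n + 1)
  have hi' : (i : ℝ) ≤ T.r n := by exact_mod_cast hi
  rw [level, level, left_offset_add T hn hi hj, width_eq T hn]
  apply Ico_subset_Ico
  · have : (0 : ℝ) ≤ i * T.width (n + 1) := by positivity
    linarith
  · nlinarith

lemma exists_mem_level_offset (hn : 1 ≤ n) (hj : j < T.height n) {x : ℝ} (hx : x ∈ T.level n j) :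
    ∃ i ≤ T.r n, x ∈ T.level (n + 1) (T.offset n i + j) := by
  have hw := T.width_pos (n + 1)
  rw [level, mem_Ico] at hx
  have h0 : 0 ≤ (x - T.left n j) / T.width (n + 1) := div_nonneg (by linarith) hw.le
  have hi : ⌊(x - T.left n j) / T.width (n + 1)⌋₊ ≤ T.r n := by
    rw [← Nat.lt_succ_iff, Nat.floor_lt h0, div_lt_iff₀ hw]
    push_cast
    rw [← width_eq T hn]
    linarith
  refine ⟨_, hi, ?_⟩
  rw [level, left_offset_add T hn hi hj, mem_Ico]
  have h2 := Nat.floor_le h0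
  have h3 := Nat.lt_floor_add_one ((x - T.left n j) / T.width (n + 1))
  rw [le_div_iff₀ hw] at h2
  rw [div_lt_iff₀ hw] at h3
  exact ⟨by linarith, by linarith⟩

lemma level_eq_biUnion (hn : 1 ≤ n) (hj : j < T.height n) :
    T.level n j = ⋃ i ∈ Finset.range (T.r n + 1), T.level (n + 1) (T.offset n i + j) := by
  apply Subset.antisymm
  · intro x hx
    obtain ⟨i, hi, h⟩ := T.exists_mem_level_offset hn hj hx
    simp only [mem_iUnion, Finset.mem_range]
    exact ⟨i, by omega, h⟩
  · simp only [iUnion_subset_iff, Finset.mem_range]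
    exact fun i hi => T.level_offset_subset hn (by omega) hj

lemma offset_lt_offset (hn : 1 ≤ n) {i i' : ℕ} (h : i < i') : T.offset n i < T.offset n i' :=
  calc _ < T.offset n (i + 1) := by have := T.height_pos hn; rw [offset_succ]; omega
    _ ≤ _ := T.offset_mono n h

/-- Column `n`, over a given point of it, reappears inside every later column. -/
lemma exists_copy (hn : 1 ≤ n) (hj : j < T.height n) {x : ℝ} (hx : x ∈ T.level n j) {m : ℕ}
    (hm : n ≤ m) : ∃ (o : ℕ) (c : ℝ), o + T.height n ≤ T.height m ∧ x ∈ T.level m (o + j) ∧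
      ∀ t < T.height n, T.left m (o + t) = T.left n t + c ∧
        (T.block m).getD (o + t) 0 = (T.block n).getD t 0 := by
  induction m, hm using Nat.le_induction with
  | base => exact ⟨0, 0, by simp, by simpa using hx, by simp⟩
  | succ m hm ih =>
    obtain ⟨o, c, h1, h2, h3⟩ := ih
    have hm1 : 1 ≤ m := hn.trans hm
    obtain ⟨i, hi, h⟩ := T.exists_mem_level_offset hm1 (by omega) h2
    refine ⟨T.offset m i + o, c + i * T.width (m + 1), ?_, by rwa [add_assoc], fun t ht => ?_⟩
    · have := T.offset_add_lt hm1 hi (j := T.height m - 1)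
        (by have := T.height_pos hm1; omega)
      omega
    · rw [add_assoc, left_offset_add T hm1 hi (by omega), block_offset_add T hm1 hi (by omega),
        (h3 t ht).1, (h3 t ht).2]
      exact ⟨by ring, rfl⟩

lemma column_mono {m : ℕ} (hn : 1 ≤ n) (hm : n ≤ m) : T.column n ⊆ T.column m := by
  intro x hx
  obtain ⟨j, hj, hx⟩ := (T.mem_column_iff hn).1 hx
  obtain ⟨o, c, h1, h2, -⟩ := T.exists_copy hn hj hx hm
  exact (T.mem_column_iff (hn.trans hm)).2 ⟨o + j, by omega, h2⟩

lemma one_le_of_lt_height (hj : j < T.height n) : 1 ≤ n := by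
  by_contra h
  have : n = 0 := by omega
  subst this
  simp [height, block] at hj

/-! ### The transformation -/

/-- Both columns reappear around x in a common later column, where both translations move x up by
one level. -/
lemma Step.unique {T : RankOne} {x y z : ℝ} (hy : T.Step x y) (hz : T.Step x z) : y = z := by
  obtain ⟨n, j, hj, hx, rfl⟩ := hy
  obtain ⟨m, k, hk, hx', rfl⟩ := hz
  have hn := T.one_le_of_lt_height hj
  have hm := T.one_le_of_lt_height hk
  obtain ⟨o, c, h1, h2, h3⟩ := T.exists_copy hn (by omega) hx (le_max_left n m)
  obtain ⟨o', c', h1', h2', h3'⟩ := T.exists_copy hm (by omega) hx' (le_max_right n m)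
  have e := T.eq_of_mem_level (hn.trans (le_max_left n m)) (by omega) (by omega) h2 h2'
  have a1 := (h3 j (by omega)).1
  have a2 := (h3 (j + 1) hj).1
  have b1 := (h3' k (by omega)).1
  have b2 := (h3' (k + 1) hk).1
  rw [← add_assoc] at a2 b2
  rw [e] at a1 a2
  linarith

lemma Step.map_eq {T : RankOne} {x y : ℝ} (h : T.Step x y) : T.map x = y := by
  have h' : ∃ y, T.Step x y := ⟨y, h⟩
  rw [map, dif_pos h']
  exact h'.choose_spec.unique h

lemma map_eq (hj : j + 1 < T.height n) {x : ℝ} (hx : x ∈ T.level n j) :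
    T.map x = x + (T.left n (j + 1) - T.left n j) :=
  Step.map_eq ⟨n, j, hj, hx, rfl⟩

lemma iterate_map_eq {l : ℕ} (hj : j + l < T.height n) {x : ℝ} (hx : x ∈ T.level n j) :
    T.map^[l] x = x + (T.left n (j + l) - T.left n j) := by
  induction l with
  | zero => simp
  | succ l ih =>
    rw [Function.iterate_succ_apply', ih (by omega), T.map_eq (j := j + l) (by omega)]
    · rw [add_assoc j l 1]; ring
    · rw [level, mem_Ico] at hx ⊢
      exact ⟨by linarith, by linarith⟩

lemma iterate_map_mem_level {l : ℕ} (hj : j + l < T.height n) {x : ℝ} (hx : x ∈ T.level n j) :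
    T.map^[l] x ∈ T.level n (j + l) := by
  rw [T.iterate_map_eq hj hx]
  rw [level, mem_Ico] at hx ⊢
  exact ⟨by linarith, by linarith⟩

/-- On a level at least l below the top, the l-th iterate is a single translation. Both invariance
of the measure and the periodicity in `sparse_uniform` rest on this. -/
lemma volume_preimage_iterate_inter_level {l : ℕ} (hj : j + l < T.height n) (E : Set ℝ) :
    volume (T.map^[l] ⁻¹' E ∩ T.level n j) = volume (E ∩ T.level n (j + l)) := by
  rw [← measure_preimage_add_right volume (T.left n (j + l) - T.left n j) (E ∩ _)]
  congr 1
  ext x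
  simp only [mem_inter_iff, mem_preimage]
  constructor
  · rintro ⟨h1, h2⟩
    rw [← T.iterate_map_eq hj h2]
    exact ⟨h1, T.iterate_map_mem_level hj h2⟩
  · rintro ⟨h1, h2⟩
    have h3 : x ∈ T.level n j := by
      rw [level, mem_Ico] at h2 ⊢
      exact ⟨by linarith, by linarith⟩
    rw [T.iterate_map_eq hj h3]
    exact ⟨h1, h3⟩

lemma measurable_map : Measurable T.map := by
  intro E hE
  have : T.map ⁻¹' E = (⋃ n, ⋃ j, ⋃ (_ : j + 1 < T.height n),
      (T.level n j ∩ (fun x => x + (T.left n (j + 1) - T.left n j)) ⁻¹' E)) ∪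
      ((⋃ n, ⋃ j, ⋃ (_ : j + 1 < T.height n), T.level n j)ᶜ ∩ E) := by
    ext x
    by_cases h : ∃ n j, j + 1 < T.height n ∧ x ∈ T.level n j
    · have h' := h
      obtain ⟨n, j, hj, hx⟩ := h
      have hm := T.map_eq hj hx
      simp only [mem_preimage, mem_union, mem_iUnion, mem_inter_iff, mem_compl_iff, exists_prop]
      simp only [h', not_true, false_and, or_false]
      constructor
      · intro hE
        exact ⟨n, j, hj, hx, hm ▸ hE⟩
      · rintro ⟨n', j', hj', hx', hE⟩
        rwa [T.map_eq hj' hx']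
    · have hm : T.map x = x := by
        rw [map, dif_neg]
        rintro ⟨y, n, j, hj, hx, -⟩
        exact h ⟨n, j, hj, hx⟩
      simp only [mem_preimage, mem_union, mem_iUnion, mem_inter_iff, mem_compl_iff, exists_prop, hm]
      simp only [h, not_false_iff, true_and]
      constructor
      · exact .inr
      · rintro (⟨n, j, hj, hx, -⟩ | h')
        · exact absurd ⟨n, j, hj, hx⟩ h
        · exact h'
  rw [this]
  refine MeasurableSet.union ?_ (MeasurableSet.inter (MeasurableSet.compl ?_) hE)
  · refine .iUnion fun n => .iUnion fun j => .iUnion fun _ => ?_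
    exact (T.measurableSet_level n j).inter ((measurable_id.add_const _) hE)
  · exact .iUnion fun n => .iUnion fun j => .iUnion fun _ => T.measurableSet_level n j

end RankOne

namespace RankOne

variable (T : RankOne) {n j : ℕ}

lemma volume_inter_level {A : Set ℝ} (hA : MeasurableSet A) (hn : 1 ≤ n) (hj : j < T.height n) :
    volume (A ∩ T.level n j) =
      ∑ i ∈ Finset.range (T.r n + 1), volume (A ∩ T.level (n + 1) (T.offset n i + j)) := by
  rw [level_eq_biUnion T hn hj, inter_iUnion₂, measure_biUnion_finset]
  · intro i hi i' hi' hne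
    simp only [Finset.coe_range, mem_Iio] at hi hi'
    refine Disjoint.mono inter_subset_right inter_subset_right
      (T.pairwiseDisjoint_level (n := n + 1) (by omega) ?_ ?_ ?_)
    · simpa using T.offset_add_lt hn (i := i) (by omega) hj
    · simpa using T.offset_add_lt hn (i := i') (by omega) hj
    · rcases lt_or_gt_of_ne hne with h | h
      · have := T.offset_lt_offset hn h
        omega
      · have := T.offset_lt_offset hn h
        omega
  · exact fun i _ => hA.inter (T.measurableSet_level _ _)

/-! ### The measure of the space -/

lemma measurableSet_column (n : ℕ) : MeasurableSet (T.column n) := measurableSet_Ico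

lemma measurableSet_space : MeasurableSet T.space := by
  rw [space_eq]
  exact .iUnion fun n => .iUnion fun _ => T.measurableSet_column n

lemma column_subset_space (hn : 1 ≤ n) : T.column n ⊆ T.space := by
  rw [space_eq]
  exact subset_iUnion₂_of_subset n hn Subset.rfl

lemma level_subset_space (hj : j < T.height n) : T.level n j ⊆ T.space :=
  fun _ hx => T.column_subset_space (T.one_le_of_lt_height hj)
    ((T.mem_column_iff (T.one_le_of_lt_height hj)).2 ⟨j, hj, hx⟩)

lemma two_mul_width_succ_le (hn : 1 ≤ n) : 2 * T.width (n + 1) ≤ T.width n := by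
  rw [width_eq T hn]
  have : (1 : ℝ) ≤ T.r n := by exact_mod_cast T.one_le_r n hn
  nlinarith [T.width_pos (n + 1)]

lemma tendsto_width : Tendsto T.width atTop (𝓝 0) := by
  rw [← tendsto_add_atTop_iff_nat 1]
  refine squeeze_zero (fun n => (T.width_pos _).le) (fun n => ?_)
    (tendsto_pow_atTop_nhds_zero_of_lt_one (r := (1 / 2 : ℝ)) (by norm_num) (by norm_num))
  induction n with
  | zero => simp [width]
  | succ n ih =>
    have := T.two_mul_width_succ_le (n := n + 1) (by omega)
    rw [pow_succ]
    linarith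

/-- The quantity on the left is nonincreasing in n and starts at 1 + 2. The new spacers have total
length at most `width n`, which is paid for by the width being at least halved. -/
lemma height_mul_width_add_le (hs : ∀ n i, T.s n i ≤ 1) (hn : 1 ≤ n) :
    T.height n * T.width n + 2 * T.width n ≤ 3 := by
  induction n, hn using Nat.le_induction with
  | base => norm_num [height, block, width]
  | succ n hn ih =>
    have h1 : T.height (n + 1) ≤ (T.r n + 1) * (T.height n + 1) := by
      rw [height_succ' T hn, mul_add]
      have := Finset.sum_le_card_nsmul (Finset.range (T.r n + 1)) (T.s n) 1 fun i _ => hs n i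
      simpa using this
    have h2 : (T.height (n + 1) : ℝ) ≤ (T.r n + 1) * (T.height n + 1) := by exact_mod_cast h1
    have h3 := T.two_mul_width_succ_le hn
    have h4 := mul_le_mul_of_nonneg_right h2 (T.width_pos (n + 1)).le
    have h5 := width_eq T hn
    nlinarith

lemma volume_space_lt_top (hs : ∀ n i, T.s n i ≤ 1) : volume T.space < ⊤ := by
  have : T.space ⊆ Ico 0 3 := by
    rw [space_eq]
    refine iUnion₂_subset fun n hn => Ico_subset_Ico_right ?_
    have := T.height_mul_width_add_le hs hn
    have := T.width_pos n
    linarith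
  exact (measure_mono this).trans_lt (by simp)

lemma volume_space_ne_zero : volume T.space ≠ 0 := by
  have h1 := measure_mono (μ := volume) (T.column_subset_space (n := 1) le_rfl)
  rw [volume_column] at h1
  have h2 : T.height 1 * T.width 1 = 1 := by simp [height, block, width]
  rw [h2] at h1
  intro h
  simp [h] at h1

section Finite

variable (hT : volume T.space < ⊤)
include hT

lemma tendsto_volume_space_diff :
    Tendsto (fun n => volume (T.space \ T.column n)) atTop (𝓝 0) := by
  rw [← tendsto_add_atTop_iff_nat 1]
  have h1 : Antitone fun n => T.space \ T.column (n + 1) := fun n m h =>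
    sdiff_subset_sdiff_right (T.column_mono (by omega) (by omega))
  have h2 : ⋂ n, T.space \ T.column (n + 1) = ∅ := by
    rw [← sdiff_iUnion, sdiff_eq_empty, space_eq]
    refine iUnion₂_subset fun n hn => ?_
    obtain ⟨n, rfl⟩ := Nat.exists_eq_add_of_le' hn
    exact subset_iUnion (fun n => T.column (n + 1)) n
  have := tendsto_measure_iInter_atTop (μ := volume)
    (fun n => (T.measurableSet_space.diff (T.measurableSet_column (n + 1))).nullMeasurableSet)
    h1 ⟨0, (measure_mono sdiff_subset |>.trans_lt hT).ne⟩
  rwa [h2, measure_empty] at this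

lemma tendsto_volume_space_diff_add (m : ℕ) :
    Tendsto (fun n => volume (T.space \ T.column n) + m * ENNReal.ofReal (T.width n))
      atTop (𝓝 0) := by
  have h := ENNReal.tendsto_ofReal T.tendsto_width
  rw [ENNReal.ofReal_zero] at h
  simpa using (T.tendsto_volume_space_diff hT).add
    (ENNReal.Tendsto.const_mul h (.inr (ENNReal.natCast_ne_top m)))

lemma tendsto_volume_column : Tendsto (fun n => volume (T.column n)) atTop (𝓝 (volume T.space)) := by
  have h : ∀ᶠ n in atTop, volume T.space - volume (T.space \ T.column n) = volume (T.column n) := by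
    filter_upwards [eventually_ge_atTop 1] with n hn
    have := measure_sdiff_add_inter (μ := volume) T.space (T.measurableSet_column n)
    rw [inter_eq_self_of_subset_right (T.column_subset_space hn)] at this
    rw [← this]
    exact ENNReal.add_sub_cancel_left (measure_mono sdiff_subset |>.trans_lt hT).ne
  refine Tendsto.congr' h ?_
  have := ENNReal.Tendsto.sub (tendsto_const_nhds (x := volume T.space) (f := atTop (α := ℕ)))
    (T.tendsto_volume_space_diff hT) (.inl hT.ne)
  simpa using this

omit hT in
lemma isProbabilityMeasure_measure (hT : volume T.space < ⊤) : IsProbabilityMeasure T.measure := by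
  constructor
  simp only [measure, Measure.smul_apply, Measure.restrict_apply_univ, smul_eq_mul]
  exact ENNReal.inv_mul_cancel T.volume_space_ne_zero hT.ne

/-! ### Invariance of the measure -/

/-- Translating all levels but the top one shows that the image measure is at most the original, up
to the top level and the part outside column n, which vanish in the limit. Two finite measures with
one below the other and equal total mass coincide. -/
lemma measurePreserving_map_restrict :
    MeasurePreserving T.map (volume.restrict T.space) (volume.restrict T.space) := by
  refine ⟨T.measurable_map, ?_⟩
  have : IsFiniteMeasure (volume.restrict T.space) := ⟨by simpa using hT⟩
  have : IsFiniteMeasure ((volume.restrict T.space).map T.map) :=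
    Measure.isFiniteMeasure_map _ _
  refine Measure.eq_of_le_of_measure_univ_eq ?_ ?_
  · refine Measure.le_iff.2 fun E hE => ?_
    rw [Measure.map_apply T.measurable_map hE, Measure.restrict_apply (T.measurable_map hE),
      Measure.restrict_apply hE]
    have hlim := (T.tendsto_volume_space_diff_add hT 1).const_add (volume (E ∩ T.space))
    rw [add_zero] at hlim
    refine ge_of_tendsto hlim ?_
    filter_upwards [eventually_ge_atTop 1] with n hn
    have hpos := T.height_pos hn
    have hsub : T.map ⁻¹' E ∩ T.space ⊆
        (⋃ j ∈ Finset.range (T.height n - 1), T.map^[1] ⁻¹' E ∩ T.level n j) ∪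
          ((T.space \ T.column n) ∪ T.level n (T.height n - 1)) := by
      rintro x ⟨hx, hxs⟩
      by_cases hc : x ∈ T.column n
      · obtain ⟨j, hj, hxj⟩ := (T.mem_column_iff hn).1 hc
        by_cases h : j < T.height n - 1
        · left
          simp only [mem_iUnion, Finset.mem_range]
          exact ⟨j, h, hx, hxj⟩
        · have : j = T.height n - 1 := by omega
          subst this
          exact .inr (.inr hxj)
      · exact .inr (.inl ⟨hxs, hc⟩)
    refine (measure_mono hsub).trans ((measure_union_le _ _).trans
      (add_le_add ?_ ((measure_union_le _ _).trans (by simp [volume_level]))))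
    refine (measure_biUnion_finset_le _ _).trans ?_
    calc ∑ j ∈ Finset.range (T.height n - 1), volume (T.map^[1] ⁻¹' E ∩ T.level n j)
        = ∑ j ∈ Finset.range (T.height n - 1), volume (E ∩ T.level n (j + 1)) :=
          Finset.sum_congr rfl fun j hj => T.volume_preimage_iterate_inter_level
            (by have := Finset.mem_range.1 hj; omega) E
      _ = volume (⋃ j ∈ Finset.range (T.height n - 1), E ∩ T.level n (j + 1)) := by
          rw [measure_biUnion_finset]
          · intro j hj j' hj' hne
            simp only [Finset.coe_range, mem_Iio] at hj hj'
            refine Disjoint.mono inter_subset_right inter_subset_right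
              (T.pairwiseDisjoint_level hn (by simp; omega) (by simp; omega) (by omega))
          · exact fun j _ => hE.inter (T.measurableSet_level _ _)
      _ ≤ _ := by
          refine measure_mono (iUnion₂_subset fun j hj => inter_subset_inter_right _
            (T.level_subset_space ?_))
          have := Finset.mem_range.1 hj
          omega
  · rw [Measure.map_apply T.measurable_map .univ]
    simp

/-! ### Sets that are equidistributed over the levels -/

-- An open set, within the space, is the increasing union of the levels of column N + n that it
-- contains, since the widths tend to 0.
omit hT in
lemma volume_inter_eq_of_uniform {A : Set ℝ} (hA : MeasurableSet A) {N : ℕ} (hN : 1 ≤ N)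
    {c : ENNReal}
    (h : ∀ n ≥ N, ∀ j < T.height n, volume (A ∩ T.level n j) = c * volume (T.level n j))
    {U : Set ℝ} (hU : IsOpen U) : volume (A ∩ (U ∩ T.space)) = c * volume (U ∩ T.space) := by
  classical
  let J : ℕ → Finset ℕ := fun n => {j ∈ Finset.range (T.height n) | T.level n j ⊆ U}
  let V : ℕ → Set ℝ := fun n => ⋃ j ∈ J (N + n), T.level (N + n) j
  have hV : Monotone V := by
    refine monotone_nat_of_le_succ fun n x hx => ?_
    simp only [V, J, mem_iUnion, Finset.mem_filter, Finset.mem_range, exists_prop] at hx ⊢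
    obtain ⟨j, ⟨hj, hjU⟩, hx⟩ := hx
    obtain ⟨i, hi, hx'⟩ := T.exists_mem_level_offset (by omega) hj hx
    have hn : 1 ≤ N + n := by omega
    exact ⟨_, ⟨T.offset_add_lt hn hi hj, (T.level_offset_subset hn hi hj).trans hjU⟩, hx'⟩
  have hVU : U ∩ T.space = ⋃ n, V n := by
    apply Subset.antisymm
    · rintro x ⟨hx, hxs⟩
      obtain ⟨ε, hε, hball⟩ := Metric.isOpen_iff.1 hU x hx
      rw [space_eq] at hxs
      obtain ⟨n₀, hn₀, hxn⟩ := mem_iUnion₂.1 hxs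
      obtain ⟨n₁, hn₁⟩ := eventually_atTop.1 ((tendsto_order.1 T.tendsto_width).2 ε hε)
      have hn : 1 ≤ N + max n₀ n₁ := by omega
      obtain ⟨j, hj, hxj⟩ := (T.mem_column_iff hn).1
        (T.column_mono hn₀ (show n₀ ≤ N + max n₀ n₁ by omega) hxn)
      simp only [V, J, mem_iUnion, Finset.mem_filter, Finset.mem_range, exists_prop]
      refine ⟨max n₀ n₁, j, ⟨hj, fun y hy => hball ?_⟩, hxj⟩
      have := hn₁ (N + max n₀ n₁) (by omega)
      rw [level, mem_Ico] at hxj hy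
      rw [Metric.mem_ball, Real.dist_eq, abs_lt]
      exact ⟨by linarith, by linarith⟩
    · refine iUnion_subset fun n => iUnion₂_subset fun j hj => ?_
      simp only [J, Finset.mem_filter, Finset.mem_range] at hj
      exact subset_inter hj.2 (T.level_subset_space hj.1)
  have hVn : ∀ n, volume (A ∩ V n) = c * volume (V n) := by
    intro n
    have hd : (J (N + n) : Set ℕ).PairwiseDisjoint (T.level (N + n)) := by
      refine (T.pairwiseDisjoint_level (by omega)).subset ?_
      exact_mod_cast Finset.filter_subset _ _
    simp only [V]
    rw [inter_iUnion₂, measure_biUnion_finset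
        (fun j hj j' hj' hne => (hd hj hj' hne).mono inter_subset_right inter_subset_right)
        (fun j _ => hA.inter (T.measurableSet_level _ _)),
      measure_biUnion_finset hd (fun j _ => T.measurableSet_level _ _), Finset.mul_sum]
    refine Finset.sum_congr rfl fun j hj => h _ (by omega) j ?_
    simp only [J, Finset.mem_filter, Finset.mem_range] at hj
    exact hj.1
  have hAV : Monotone fun n => A ∩ V n := fun n m h => inter_subset_inter_right _ (hV h)
  rw [hVU, inter_iUnion, hAV.measure_iUnion, hV.measure_iUnion, ENNReal.mul_iSup]
  exact iSup_congr hVn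

/-- The density c of A in a level is the same for all levels and all n ≥ N, because a level splits
into levels of the next column. Hence restricting the measure to A is multiplication by c, and
evaluating at Aᶜ gives c = 0 or Aᶜ null. -/
lemma ae_empty_or_univ_of_uniform {A : Set ℝ} (hA : MeasurableSet A) {N : ℕ} (hN : 1 ≤ N)
    (h : ∀ n ≥ N, ∀ j < T.height n, ∀ j' < T.height n,
      volume (A ∩ T.level n j) = volume (A ∩ T.level n j')) :
    volume.restrict T.space A = 0 ∨ volume.restrict T.space Aᶜ = 0 := by
  have hw : ∀ n, ENNReal.ofReal (T.width n) ≠ 0 := fun n => by simpa using T.width_pos n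
  obtain ⟨c, hc⟩ : ∃ c : ENNReal, c = volume (A ∩ T.level N 0) / ENNReal.ofReal (T.width N) :=
    ⟨_, rfl⟩
  have hκ : ∀ n ≥ N, volume (A ∩ T.level n 0) = c * ENNReal.ofReal (T.width n) := by
    intro n hn
    induction n, hn using Nat.le_induction with
    | base => rw [hc, ENNReal.div_mul_cancel (hw N) ENNReal.ofReal_ne_top]
    | succ n hn ih =>
      have hn1 : 1 ≤ n := hN.trans hn
      have hpos := T.height_pos hn1
      rw [T.volume_inter_level hA hn1 hpos, Finset.sum_congr rfl fun i hi => h (n + 1) (by omega)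
          (T.offset n i + 0) (T.offset_add_lt hn1 (by have := Finset.mem_range.1 hi; omega) hpos) 0
          (T.height_pos (by omega)), Finset.sum_const, Finset.card_range, nsmul_eq_mul,
        width_eq T hn1, ENNReal.ofReal_mul (by positivity), mul_left_comm,
        show ((T.r n : ℝ) + 1) = ((T.r n + 1 : ℕ) : ℝ) by push_cast; rfl,
        ENNReal.ofReal_natCast] at ih
      exact (ENNReal.mul_right_inj (by simp) (ENNReal.natCast_ne_top _)).1 ih
  have hU : ∀ U, IsOpen U → volume (A ∩ (U ∩ T.space)) = c * volume (U ∩ T.space) :=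
    fun U hU => T.volume_inter_eq_of_uniform hA hN (fun n hn j hj => by
      rw [h n hn j hj 0 (by omega), hκ n hn, volume_level]) hU
  have : IsFiniteMeasure (volume.restrict T.space) := ⟨by simpa using hT⟩
  have hext : (volume.restrict T.space).restrict A = c • volume.restrict T.space := by
    refine ext_of_generate_finite {U : Set ℝ | IsOpen U} (BorelSpace.measurable_eq)
      isPiSystem_isOpen (fun U hUo => ?_) ?_
    · have hm : MeasurableSet U := IsOpen.measurableSet hUo
      rw [Measure.restrict_apply hm, Measure.restrict_apply (hm.inter hA), Measure.smul_apply,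
        Measure.restrict_apply hm, smul_eq_mul, ← hU U hUo]
      congr 1
      ext x
      simp only [mem_inter_iff]
      tauto
    · have := hU univ isOpen_univ
      rw [univ_inter] at this
      rw [Measure.restrict_apply_univ, Measure.restrict_apply hA, this, Measure.smul_apply,
        Measure.restrict_apply_univ, smul_eq_mul]
  have h1 : (volume.restrict T.space).restrict A Aᶜ = 0 := by
    rw [Measure.restrict_apply hA.compl, compl_inter_self, measure_empty]
  rw [hext, Measure.smul_apply, smul_eq_mul, mul_eq_zero] at h1
  refine h1.imp_left fun h0 => ?_
  have h2 := congrArg (fun μ => μ univ) hext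
  simpa [h0] using h2

lemma totallyErgodic_of_uniform
    (h : ∀ l : ℕ, 1 ≤ l → ∀ A : Set ℝ, MeasurableSet A → T.map^[l] ⁻¹' A = A →
      ∃ N, 1 ≤ N ∧ ∀ n ≥ N, ∀ j < T.height n, ∀ j' < T.height n,
        volume (A ∩ T.level n j) = volume (A ∩ T.level n j')) :
    TotallyErgodic T.map T.measure := by
  intro l hl
  refine Ergodic.smul_measure ⟨(T.measurePreserving_map_restrict hT).iterate l, ⟨?_⟩⟩ _
  intro A hA hinv
  obtain ⟨N, hN, hu⟩ := h l hl A hA hinv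
  rw [eventuallyConst_set']
  rcases T.ae_empty_or_univ_of_uniform hT hA hN hu with h0 | h0
  · exact .inl (ae_eq_empty.2 h0)
  · exact .inr (ae_eq_univ.2 h0)

end Finite

end RankOne

/-! ### Sums over residue classes -/

lemma sum_range_mul {M : Type*} [AddCommMonoid M] (f : ℕ → M) (P K : ℕ) :
    ∑ i ∈ Finset.range (P * K), f i =
      ∑ q ∈ Finset.range K, ∑ u ∈ Finset.range P, f (P * q + u) := by
  induction K with
  | zero => simp
  | succ K ih => rw [Nat.mul_succ, Finset.sum_range_add, ih, Finset.sum_range_succ]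

lemma pos_and_pos_of_two_le_mul {a b : ℕ} (h : 2 ≤ a * b) : 0 < a ∧ 0 < b :=
  CanonicallyOrderedAdd.mul_pos.1 (by omega)

lemma sum_range_zmod {M : Type*} [AddCommMonoid M] {l : ℕ} [NeZero l] (F : ZMod l → M) (m : ℕ) :
    ∑ q ∈ Finset.range (l * m), F q = m • ∑ z, F z := by
  have h : ∑ u ∈ Finset.range l, F u = ∑ z, F z := by
    refine Finset.sum_bij' (fun u _ => (u : ZMod l)) (fun z _ => z.val) ?_ ?_ ?_ ?_ ?_
    · simp
    · exact fun z _ => Finset.mem_range.2 z.val_lt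
    · exact fun u hu => ZMod.val_cast_of_lt (Finset.mem_range.1 hu)
    · exact fun z _ => ZMod.natCast_zmod_val z
    · simp
  rw [sum_range_mul]
  simp [h]

/-! ### The sparse construction and its total ergodicity -/

namespace RankOne

/-- The construction in which `B_{n+1} = D ⋯ D` with `K n` copies of `D = B_n 1 B_n 1 ⋯ 1 B_n`,
where `D` has `P n` copies of `B_n`. -/
def sparse (P K : ℕ → ℕ) (h : ∀ n, 1 ≤ n → 2 ≤ P n * K n) : RankOne where
  r n := P n * K n - 1
  s n i := if P n ∣ i + 1 then 0 else 1
  one_le_r n hn := by have := h n hn; omega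

variable {P K : ℕ → ℕ} (h : ∀ n, 1 ≤ n → 2 ≤ P n * K n) {n : ℕ}

lemma sparse_r_add_one (hn : 1 ≤ n) : (sparse P K h).r n + 1 = P n * K n := by
  have := h n hn
  simp only [sparse]
  omega

lemma sparse_s_le (n i : ℕ) : (sparse P K h).s n i ≤ 1 := by
  simp only [sparse]
  split_ifs <;> simp

/-- Each subcolumn would contribute height + 1, but every `P n`-th one has no spacer; i / P n counts
those among the first i. -/
lemma sparse_offset_add (n i : ℕ) :
    (sparse P K h).offset n i + i / P n = i * ((sparse P K h).height n + 1) := by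
  induction i with
  | zero => simp [offset]
  | succ i ih =>
    rw [offset_succ, Nat.succ_div, add_one_mul, ← ih]
    simp only [sparse]
    split_ifs <;> omega

/-- The missing spacers shift successive copies of D by -1 mod l, so the pieces of a level of column
n are spread evenly over the residues mod l in column n + 1. -/
lemma sparse_uniform (hP : ∀ l, 1 ≤ l → ∀ n ≥ l, l ∣ P n) (hK : ∀ l, 1 ≤ l → ∀ n ≥ l, l ∣ K n)
    {l : ℕ} (hl : 1 ≤ l) {A : Set ℝ} (hA : MeasurableSet A)
    (hinv : (sparse P K h).map^[l] ⁻¹' A = A) :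
    ∀ n ≥ l, ∀ j < (sparse P K h).height n, ∀ j' < (sparse P K h).height n,
      volume (A ∩ (sparse P K h).level n j) = volume (A ∩ (sparse P K h).level n j') := by
  set T := sparse P K h with hTdef
  intro n hn
  have hn1 : 1 ≤ n := hl.trans hn
  have : NeZero l := ⟨by omega⟩
  have hPpos : 0 < P n := (pos_and_pos_of_two_le_mul (h n hn1)).1
  have hper : ∀ m t, t + l * m < T.height (n + 1) →
      volume (A ∩ T.level (n + 1) (t + l * m)) = volume (A ∩ T.level (n + 1) t) := by
    intro m t
    induction m with
    | zero => simp
    | succ m ih =>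
      intro ht
      rw [← ih (by rw [Nat.mul_succ] at ht; omega), Nat.mul_succ, ← add_assoc,
        ← T.volume_preimage_iterate_inter_level (by rw [Nat.mul_succ] at ht; omega), hinv]
  let G : ZMod l → ENNReal := fun z => volume (A ∩ T.level (n + 1) z.val)
  have hG : ∀ t < T.height (n + 1), volume (A ∩ T.level (n + 1) t) = G t := by
    intro t ht
    have h1 := Nat.mod_add_div t l
    simp only [G, ZMod.val_natCast]
    rw [← hper (t / l) (t % l) (by omega), h1]
  obtain ⟨m, hm⟩ := hK l hl n hn
  -- The right-hand side does not involve j; here m = K n / l.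
  suffices ∀ j < T.height n,
      volume (A ∩ T.level n j) = ∑ u ∈ Finset.range (P n), m • ∑ z, G z from
    fun j hj j' hj' => by rw [this j hj, this j' hj']
  intro j hj
  rw [T.volume_inter_level hA hn1 hj, sparse_r_add_one h hn1, sum_range_mul, Finset.sum_comm]
  refine Finset.sum_congr rfl fun u hu => ?_
  have hu := Finset.mem_range.1 hu
  have key : ∀ q ∈ Finset.range (K n),
      volume (A ∩ T.level (n + 1) (T.offset n (P n * q + u) + j)) =
        G ((u * (T.height n + 1) + j : ℕ) - (q : ZMod l)) := by
    intro q hq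
    have hq := Finset.mem_range.1 hq
    have hi : P n * q + u ≤ T.r n := by
      have h1 : T.r n + 1 = P n * K n := sparse_r_add_one h hn1
      have h2 : P n * q + P n ≤ P n * K n := by
        rw [← Nat.mul_succ]; exact Nat.mul_le_mul_left _ hq
      omega
    rw [hG _ (T.offset_add_lt hn1 hi hj)]
    congr 1
    have h1 := sparse_offset_add h n (P n * q + u)
    rw [Nat.mul_add_div hPpos, Nat.div_eq_of_lt hu, add_zero] at h1
    have h2 := congrArg (Nat.cast : ℕ → ZMod l) h1
    -- As l divides P n, the index q enters the offset mod l only through the q missing spacers.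
    have h3 : ((P n : ℕ) : ZMod l) = 0 := (ZMod.natCast_eq_zero_iff _ _).2 (hP l hl n hn)
    push_cast at h2 ⊢
    rw [h3, zero_mul, zero_add] at h2
    rw [← hTdef] at h2
    rw [← h2]
    ring
  rw [Finset.sum_congr rfl key, hm, sum_range_zmod
    (fun z => G (((u * (T.height n + 1) + j : ℕ) : ZMod l) - z)) m]
  congr 1
  -- The reflection z ↦ a - z permutes the residues, which removes the dependence on u and j.
  exact Equiv.sum_comp (Equiv.subLeft ((u * (T.height n + 1) + j : ℕ) : ZMod l)) G

lemma sparse_totallyErgodic (hP : ∀ l, 1 ≤ l → ∀ n ≥ l, l ∣ P n)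
    (hK : ∀ l, 1 ≤ l → ∀ n ≥ l, l ∣ K n) :
    TotallyErgodic (sparse P K h).map (sparse P K h).measure :=
  totallyErgodic_of_uniform _ (volume_space_lt_top _ (sparse_s_le h)) fun l hl _ hA hinv =>
    ⟨l, hl, sparse_uniform h hP hK hl hA hinv⟩

/-! ### The words of the construction -/

/-- The word `B1B1⋯1B` with `P` copies of `B`. -/
def spacedPower (B : List (Fin 2)) (P : ℕ) : List (Fin 2) :=
  (List.replicate (P - 1) (B ++ [1])).flatten ++ B

lemma spacedPower_append (B : List (Fin 2)) {P : ℕ} (hP : 1 ≤ P) :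
    spacedPower B P ++ [1] = (List.replicate P (B ++ [1])).flatten := by
  obtain ⟨P, rfl⟩ := Nat.exists_eq_add_of_le' hP
  simp [spacedPower, List.replicate_succ']

lemma length_spacedPower (B : List (Fin 2)) {P : ℕ} (hP : 1 ≤ P) :
    (spacedPower B P).length + 1 = P * (B.length + 1) := by
  have := congrArg List.length (spacedPower_append B hP)
  simpa using this

lemma spacedPower_ne_nil {B : List (Fin 2)} (hB : B ≠ []) (P : ℕ) : spacedPower B P ≠ [] := by
  simp [spacedPower, hB]

lemma map_const_range {α : Type*} (a : α) (p : ℕ) :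
    (List.range p).map (fun _ => a) = List.replicate p a := by
  simp [List.map_const']

lemma flatMap_range_mul {α : Type*} (g : ℕ → List α) (P K : ℕ)
    (hg : ∀ q u, u < P → g (P * q + u) = g u) :
    (List.range (P * K)).flatMap g = (List.replicate K ((List.range P).flatMap g)).flatten := by
  induction K with
  | zero => simp
  | succ K ih =>
    rw [Nat.mul_succ, List.range_add, List.flatMap_append, ih, List.replicate_succ',
      List.flatten_append, List.flatten_singleton, List.flatMap_map]
    congr 1
    simp only [List.flatMap]
    congr 1
    exact List.map_congr_left fun u hu => hg K u (List.mem_range.1 hu)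

lemma sparse_block_succ (hn : 1 ≤ n) : (sparse P K h).block (n + 1) =
    (List.replicate (K n) (spacedPower ((sparse P K h).block n) (P n))).flatten := by
  have hr := sparse_r_add_one h hn
  have hPpos : 0 < P n := (pos_and_pos_of_two_le_mul (h n hn)).1
  obtain ⟨n, rfl⟩ := Nat.exists_eq_add_of_le' hn
  rw [block, hr, flatMap_range_mul]
  · congr 2
    obtain ⟨p, hp⟩ := Nat.exists_eq_add_of_le' (show 1 ≤ P (n + 1) by omega)
    rw [hp, spacedPower, List.range_succ, List.flatMap_append, List.flatMap_singleton]
    have h1 : (sparse P K h).s (n + 1) p = 0 := by simp [sparse, hp]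
    rw [h1, List.replicate_zero, List.append_nil, Nat.add_sub_cancel]
    congr 1
    rw [List.flatMap, ← map_const_range]
    congr 1
    refine List.map_congr_left fun i hi => ?_
    have hi := List.mem_range.1 hi
    have h2 : (sparse P K h).s (n + 1) i = 1 := by
      simp only [sparse, hp]
      rw [if_neg]
      exact Nat.not_dvd_of_pos_of_lt (by omega) (by omega)
    rw [h2, List.replicate_one]
  · intro q u hu
    congr 2
    simp only [sparse]
    simp only [add_assoc, Nat.dvd_add_right (Dvd.intro q rfl : P (n + 1) ∣ P (n + 1) * q)]

lemma sparse_stacked (hn : 1 ≤ n) {m : ℕ} (hm : n ≤ m) :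
    Stacked ((sparse P K h).block n) ((sparse P K h).block m) := by
  induction m, hm using Nat.le_induction with
  | base => exact .base
  | succ m hm ih =>
    have hm1 : 1 ≤ m := hn.trans hm
    have hr := sparse_r_add_one h hm1
    obtain ⟨m, rfl⟩ := Nat.exists_eq_add_of_le' hm1
    have := ih.flatMap _ (sparse_s_le h (m + 1)) ((sparse P K h).r (m + 1))
    convert this using 1
    rw [block, List.range_succ, List.flatMap_append, List.flatMap_singleton]
    have hs : (sparse P K h).s (m + 1) ((sparse P K h).r (m + 1)) = 0 := by
      simp only [sparse] at hr ⊢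
      rw [hr, if_pos (Dvd.intro _ rfl)]
    rw [hs, List.replicate_zero, List.append_nil]

lemma block_infix_succ (T : RankOne) (hn : 1 ≤ n) : T.block n <:+: T.block (n + 1) := by
  obtain ⟨n, rfl⟩ := Nat.exists_eq_add_of_le' hn
  rw [block, Nat.add_comm (T.r (n + 1)) 1, List.range_add, List.flatMap_append]
  apply List.infix_append_of_infix_left
  simpa using List.infix_append_left

lemma block_infix (T : RankOne) {m : ℕ} (hm : n ≤ m) : T.block n <:+: T.block m := by
  induction m, hm using Nat.le_induction with
  | base => exact List.infix_rfl
  | succ m hm ih =>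
    rcases Nat.eq_zero_or_pos m with rfl | hm0
    · have : n = 0 := by omega
      subst this
      exact List.nil_infix
    · exact ih.trans (T.block_infix_succ hm0)

/-- All later blocks are stacked from copies of `block (n + 1)`, of which a word this short meets at
most two. As this block is a power of D, it generates the same periodic sequence as D. -/
lemma sparse_nearPeriodic (hn : 1 ≤ n) {q : ℕ} (hq : q ≤ (sparse P K h).height (n + 1)) :
    NearPeriodic (sparse P K h).subshift (spacedPower ((sparse P K h).block n) (P n)) q := by
  have hKpos : 0 < K n := (pos_and_pos_of_two_le_mul (h n hn)).2
  have hper : per ((sparse P K h).block (n + 1)) =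
      per (spacedPower ((sparse P K h).block n) (P n)) := by
    rw [sparse_block_succ h hn, per_flatten_replicate _ hKpos]
  rintro w ⟨x, hx, k, hw⟩ rfl
  obtain ⟨m, hm⟩ := hx k w.length
  rw [hw] at hm
  have h1 := hm.trans ((sparse P K h).block_infix (le_max_left m (n + 1)))
  have h2 := sparse_stacked h (n := n + 1) (by omega) (le_max_right m (n + 1))
  rcases h2.infix_of_length_le h1 hq with h3 | h3
  · obtain ⟨i, hi⟩ := exists_wordAt_per h3
    exact ⟨i, .inl (by rwa [← hper])⟩
  · obtain ⟨i, hi⟩ := exists_wordAt_ins h3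
    refine ⟨i, .inr ?_⟩
    rw [hi, length_wordAt]
    refine wordAt_congr fun t _ _ => ?_
    simp only [ins, hper]

end RankOne

/-! ### The shift and its cylinders -/

lemma measurable_shift {A : Type*} [MeasurableSpace A] : Measurable (shift (A := A)) :=
  measurable_pi_lambda _ fun k => measurable_pi_apply (k + 1)

lemma iterate_shift {A : Type*} (x : ℤ → A) (l : ℕ) (k : ℤ) : shift^[l] x k = x (k + l) := by
  induction l generalizing x with
  | zero => simp
  | succ l ih =>
    rw [Function.iterate_succ_apply, ih, shift]
    congr 1
    push_cast
    ring

lemma measurableSet_wordCylinder {A : Type*} [MeasurableSpace A] [MeasurableSingletonClass A]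
    (k : ℤ) (w : List A) : MeasurableSet (wordCylinder k w) := by
  have : wordCylinder k w = ⋂ i : Fin w.length, (fun x : ℤ → A => x (k + i)) ⁻¹' {w[i]} := by
    ext x
    simp only [wordCylinder, wordAt, mem_ofPred_eq, mem_iInter, mem_preimage, mem_singleton_iff]
    constructor
    · intro h i
      have := List.getElem_of_eq h (i := i) (by simp)
      simpa using this
    · intro h
      exact List.ext_getElem (by simp) fun i h1 h2 => by simpa using h ⟨i, h2⟩
  rw [this]
  exact .iInter fun i => measurable_pi_apply _ (measurableSet_singleton _)

lemma wordCylinder_add_one {A : Type*} (k : ℤ) (w : List A) :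
    wordCylinder (k + 1) w = shift ⁻¹' wordCylinder k w := by
  ext x
  simp only [wordCylinder, wordAt, shift, mem_ofPred_eq, mem_preimage]
  rw [show (fun i : Fin w.length => x (k + 1 + (i : ℤ))) = fun i : Fin w.length =>
    x (k + (i : ℤ) + 1) by funext i; congr 1; ring]

namespace RankOne

variable (T : RankOne) {n j : ℕ}

/-! ### Coding points by their orbits -/

open Classical in
/-- The biinfinite sequence that is read off along the orbit of `x`. -/
noncomputable def coding (x : ℝ) (k : ℤ) : Fin 2 :=
  if ∃ n j i : ℕ, i < T.height n ∧ j < T.height n ∧ (j : ℤ) + k = i ∧ (T.block n).getD i 0 = 0 ∧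
    x ∈ T.level n j then 0 else 1

lemma measurable_coding : Measurable T.coding := by
  refine measurable_pi_lambda _ fun k => Measurable.ite ?_ measurable_const measurable_const
  simp only [ofPred_exists, ofPred_and]
  refine .iUnion fun n => .iUnion fun j => .iUnion fun i => .inter (.const _) <|
    .inter (.const _) <| .inter (.const _) <| .inter (.const _) (T.measurableSet_level n j)

/-- The letter does not depend on the column used: two columns through x reappear, with their
letters, in a common later one. -/
lemma coding_eq {i : ℕ} {k : ℤ} (hi : i < T.height n) (hj : j < T.height n) (hk : (j : ℤ) + k = i)
    {x : ℝ} (hx : x ∈ T.level n j) : T.coding x k = (T.block n).getD i 0 := by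
  by_cases h0 : (T.block n).getD i 0 = 0
  · rw [h0, coding, if_pos ⟨n, j, i, hi, hj, hk, h0, hx⟩]
  · have h1 : (T.block n).getD i 0 = 1 := by
      generalize (T.block n).getD i 0 = a at h0
      fin_cases a <;> simp_all
    rw [h1, coding, if_neg]
    rintro ⟨m, j', i', hi', hj', hk', h0', hx'⟩
    have hn := T.one_le_of_lt_height hi
    have hm := T.one_le_of_lt_height hi'
    obtain ⟨o, c, a1, a2, a3⟩ := T.exists_copy hn hj hx (le_max_left n m)
    obtain ⟨o', c', b1, b2, b3⟩ := T.exists_copy hm hj' hx' (le_max_right n m)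
    have e := T.eq_of_mem_level (hn.trans (le_max_left n m)) (by omega) (by omega) a2 b2
    have e' : o + i = o' + i' := by omega
    rw [← (a3 i hi).2, e', (b3 i' hi').2] at h0
    exact h0 h0'

lemma wordAt_coding {i l : ℕ} {k : ℤ} (hi : i + l ≤ T.height n) (hj : j < T.height n)
    (hk : (j : ℤ) + k = i) {x : ℝ} (hx : x ∈ T.level n j) :
    wordAt (T.coding x) k l = ((T.block n).drop i).take l := by
  have hlen : (T.block n).length = T.height n := rfl
  refine List.ext_getElem (by simp [wordAt]; omega) fun t h1 h2 => ?_
  have ht : t < l := by simpa [wordAt] using h1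
  simp only [wordAt, List.getElem_ofFn, List.getElem_take, List.getElem_drop]
  rw [T.coding_eq (i := i + t) (by omega) hj (by push_cast; omega) hx,
    List.getD_eq_getElem _ _ (by omega)]

section Finite

variable (hT : volume T.space < ⊤)
include hT

/-- Almost every point lies far from the bottom and from the top of some column. -/
lemma ae_exists_mem_level (m : ℕ) : ∀ᵐ x ∂volume.restrict T.space,
    ∃ n j, m ≤ j ∧ j + m < T.height n ∧ x ∈ T.level n j := by
  rw [ae_restrict_iff' T.measurableSet_space, ae_iff]
  have hlim := T.tendsto_volume_space_diff_add hT (m + (m + 1))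
  refine le_antisymm (ge_of_tendsto hlim ?_) zero_le
  filter_upwards [eventually_ge_atTop 1] with n hn
  have hsub : {x | ¬(x ∈ T.space → ∃ n j, m ≤ j ∧ j + m < T.height n ∧ x ∈ T.level n j)} ⊆
      (T.space \ T.column n) ∪ ((⋃ j ∈ Finset.range m, T.level n j) ∪
        ⋃ j ∈ Finset.range (m + 1), T.level n (T.height n - j)) := by
    intro x hx
    simp only [mem_ofPred_eq, Classical.not_imp] at hx
    by_cases hc : x ∈ T.column n
    · right
      obtain ⟨j, hj, hxj⟩ := (T.mem_column_iff hn).1 hc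
      simp only [mem_union, mem_iUnion, Finset.mem_range, exists_prop]
      by_cases h1 : j < m
      · exact .inl ⟨j, h1, hxj⟩
      · refine .inr ⟨T.height n - j, ?_, by rwa [Nat.sub_sub_self hj.le]⟩
        by_contra h2
        exact hx.2 ⟨n, j, by omega, by omega, hxj⟩
    · exact .inl ⟨hx.1, hc⟩
  refine (measure_mono hsub).trans ((measure_union_le _ _).trans (add_le_add le_rfl ?_))
  refine (measure_union_le _ _).trans ((add_le_add (measure_biUnion_finset_le _ _)
    (measure_biUnion_finset_le _ _)).trans ?_)
  simp only [volume_level, Finset.sum_const, Finset.card_range, nsmul_eq_mul]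
  rw [← add_mul]
  push_cast
  exact le_rfl

omit hT in
lemma ae_measure_of_ae_restrict {p : ℝ → Prop} (h : ∀ᵐ x ∂volume.restrict T.space, p x) :
    ∀ᵐ x ∂T.measure, p x :=
  Measure.ae_smul_measure h _

/-- Off a null set every finite stretch of the orbit is seen inside one column, so the default
values in `map` and `coding` play no role. -/
lemma ae_forall_exists_mem_level : ∀ᵐ x ∂T.measure,
    ∀ m, ∃ n j, m ≤ j ∧ j + m < T.height n ∧ x ∈ T.level n j :=
  T.ae_measure_of_ae_restrict (ae_all_iff.2 (T.ae_exists_mem_level hT))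

lemma ae_coding_iterate_map (l : ℕ) :
    ∀ᵐ x ∂T.measure, T.coding (T.map^[l] x) = shift^[l] (T.coding x) := by
  filter_upwards [T.ae_forall_exists_mem_level hT] with x hx
  funext k
  rw [iterate_shift]
  obtain ⟨n, j, h1, h2, h3⟩ := hx (k.natAbs + l)
  have hi : (j : ℤ) + (k + l) = ((j + (k + l)).toNat : ℕ) := by omega
  rw [T.coding_eq (by omega) (by omega) hi h3,
    T.coding_eq (i := (j + (k + l)).toNat) (j := j + l) (n := n) (by omega) (by omega)
      (by push_cast; omega) (T.iterate_map_mem_level (by omega) h3)]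

lemma measurePreserving_map : MeasurePreserving T.map T.measure T.measure :=
  (T.measurePreserving_map_restrict hT).smul_measure _

/-- The distribution of the codings. -/
noncomputable def codingMeasure (T : RankOne) : Measure (ℤ → Fin 2) := T.measure.map T.coding

omit hT in
lemma isProbabilityMeasure_codingMeasure (hT : volume T.space < ⊤) :
    IsProbabilityMeasure T.codingMeasure :=
  have := T.isProbabilityMeasure_measure hT
  Measure.isProbabilityMeasure_map T.measurable_coding.aemeasurable

lemma measurePreserving_shift : MeasurePreserving shift T.codingMeasure T.codingMeasure := by
  refine ⟨measurable_shift, ?_⟩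
  have h1 : shift ∘ T.coding =ᵐ[T.measure] T.coding ∘ T.map := by
    filter_upwards [T.ae_coding_iterate_map hT 1] with x hx using hx.symm
  rw [codingMeasure, Measure.map_map measurable_shift T.measurable_coding, Measure.map_congr h1,
    ← Measure.map_map T.measurable_coding T.measurable_map, (T.measurePreserving_map hT).map_eq]

/-- Ergodicity of each power passes to factors. The coding intertwines the maps only almost
everywhere, so the pulled-back set is invariant only mod null sets. -/
lemma totallyErgodic_shift (h : TotallyErgodic T.map T.measure) :
    TotallyErgodic shift T.codingMeasure := by
  intro l hl
  refine ⟨(T.measurePreserving_shift hT).iterate l, ⟨fun s hs hinv => ?_⟩⟩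
  have hA : T.map^[l] ⁻¹' (T.coding ⁻¹' s) =ᵐ[T.measure] T.coding ⁻¹' s := by
    filter_upwards [T.ae_coding_iterate_map hT l] with x hx
    change (T.coding (T.map^[l] x) ∈ s) = (T.coding x ∈ s)
    rw [hx, ← mem_preimage, hinv]
  have h1 := (h l hl).quasiErgodic.ae_empty_or_univ₀
    (T.measurable_coding hs).nullMeasurableSet hA
  rw [eventuallyConst_set']
  refine h1.imp (fun h0 => ?_) fun h0 => ?_
  · rw [ae_eq_empty] at h0 ⊢
    rwa [codingMeasure, Measure.map_apply T.measurable_coding hs]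
  · rw [ae_eq_univ] at h0 ⊢
    rwa [codingMeasure, Measure.map_apply T.measurable_coding hs.compl]

lemma codingMeasure_compl_subshift : T.codingMeasure T.subshiftᶜ = 0 := by
  have hm : MeasurableSet T.subshift := by
    have : T.subshift = ⋂ (k : ℤ) (l : ℕ), ⋃ n, ⋃ w ∈ {w : List (Fin 2) | w <:+: T.block n},
        ⋃ _ : w.length = l, wordCylinder k w := by
      ext x
      simp only [subshift, wordCylinder, mem_ofPred_eq, mem_iInter, mem_iUnion, exists_prop]
      refine forall₂_congr fun k l => exists_congr fun n => ⟨fun h => ?_, ?_⟩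
      · exact ⟨_, h, length_wordAt _ _ _, by rw [length_wordAt]⟩
      · rintro ⟨w, h, rfl, hw⟩
        rwa [hw]
    rw [this]
    exact .iInter fun k => .iInter fun l => .iUnion fun n => .biUnion (to_countable _)
      fun w _ => .iUnion fun _ => measurableSet_wordCylinder k w
  rw [codingMeasure, Measure.map_apply T.measurable_coding hm.compl]
  refine measure_mono_null (t := {x | ¬∀ m, ∃ n j, m ≤ j ∧ j + m < T.height n ∧ x ∈ T.level n j})
    (fun x hx hgood => hx ?_) (T.ae_forall_exists_mem_level hT)
  intro k l
  obtain ⟨n, j, h1, h2, h3⟩ := hgood (k.natAbs + l)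
  have hi : (j : ℤ) + k = ((j + k).toNat : ℕ) := by omega
  refine ⟨n, ?_⟩
  rw [T.wordAt_coding (by omega) (by omega) hi h3]
  exact (List.take_prefix _ _).isInfix.trans (List.drop_suffix _ _).isInfix

/-! ### The empirical measure -/

/-- The levels of column n at which w starts make up the set of points whose coding begins with w,
up to the part outside the column and the top |w| levels. -/
lemma tendsto_count_mul_width (w : List (Fin 2)) :
    Tendsto (fun n => T.count n w * ENNReal.ofReal (T.width n)) atTop
      (𝓝 (volume (T.coding ⁻¹' wordCylinder 0 w ∩ T.space))) := by
  set S := T.coding ⁻¹' wordCylinder 0 w ∩ T.space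
  have hS : volume S < ⊤ := (measure_mono inter_subset_right).trans_lt hT
  have hlim := ENNReal.Tendsto.sub (tendsto_const_nhds (x := volume S) (f := atTop (α := ℕ)))
    (T.tendsto_volume_space_diff_add hT (w.length + 1)) (.inl hS.ne)
  rw [tsub_zero] at hlim
  let F : ℕ → Finset ℕ := fun n => (Finset.range (T.height n - w.length)).filter fun j =>
    ((T.block n).drop j).take w.length = w
  have hcount : ∀ n ≥ 1, volume (⋃ j ∈ F n, T.level n j) =
      T.count n w * ENNReal.ofReal (T.width n) := by
    intro n hn
    have hd : (F n : Set ℕ).PairwiseDisjoint (T.level n) := by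
      refine (T.pairwiseDisjoint_level hn).subset fun j hj => ?_
      simp only [F, Finset.coe_filter, Finset.mem_range, mem_ofPred_eq] at hj
      simp only [Finset.coe_range, mem_Iio]
      omega
    rw [measure_biUnion_finset hd fun j _ => T.measurableSet_level n j]
    simp [volume_level, count, F]
  refine tendsto_of_tendsto_of_tendsto_of_le_of_le' hlim tendsto_const_nhds ?_ ?_
  · filter_upwards [eventually_ge_atTop 1] with n hn
    rw [tsub_le_iff_right, ← hcount n hn]
    -- The term j = 0 is no level of the column but a default interval of the same width; it only
    -- enlarges the bound.
    have hsub : S ⊆ (⋃ j ∈ F n, T.level n j) ∪ ((T.space \ T.column n) ∪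
        ⋃ j ∈ Finset.range (w.length + 1), T.level n (T.height n - j)) := by
      rintro x ⟨hx, hxs⟩
      by_cases hc : x ∈ T.column n
      · obtain ⟨j, hj, hxj⟩ := (T.mem_column_iff hn).1 hc
        simp only [mem_union, mem_iUnion, Finset.mem_range, exists_prop]
        by_cases h1 : j < T.height n - w.length
        · refine .inl ⟨j, ?_, hxj⟩
          simp only [F, Finset.mem_filter, Finset.mem_range]
          refine ⟨h1, ?_⟩
          rw [← T.wordAt_coding (k := 0) (by omega) hj (by simp) hxj]
          exact hx
        · exact .inr (.inr ⟨T.height n - j, by omega, by rwa [Nat.sub_sub_self hj.le]⟩)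
      · exact .inr (.inl ⟨hxs, hc⟩)
    refine (measure_mono hsub).trans ((measure_union_le _ _).trans (add_le_add le_rfl ?_))
    refine (measure_union_le _ _).trans (add_le_add le_rfl ((measure_biUnion_finset_le _ _).trans ?_))
    simp [volume_level]
  · filter_upwards [eventually_ge_atTop 1] with n hn
    rw [← hcount n hn]
    refine measure_mono (iUnion₂_subset fun j hj x hx => ?_)
    simp only [F, Finset.mem_filter, Finset.mem_range] at hj
    refine ⟨?_, T.level_subset_space (by omega) hx⟩
    change wordAt (T.coding x) 0 w.length = w
    rw [T.wordAt_coding (i := j) (by omega) (by omega) (by simp) hx, hj.2]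

lemma tendsto_height_sub_mul_width (l : ℕ) :
    Tendsto (fun n => ((T.height n : ℝ) - l) * T.width n) atTop (𝓝 (volume T.space).toReal) := by
  have h1 := (ENNReal.tendsto_toReal hT.ne).comp (T.tendsto_volume_column hT)
  have h2 := h1.sub (T.tendsto_width.const_mul (l : ℝ))
  rw [mul_zero, sub_zero] at h2
  refine h2.congr fun n => ?_
  have := T.width_pos n
  simp only [Function.comp, volume_column]
  rw [ENNReal.toReal_ofReal (by positivity)]
  ring

lemma codingMeasure_wordCylinder (w : List (Fin 2)) (k : ℤ) :
    T.codingMeasure (wordCylinder k w) = T.codingMeasure (wordCylinder 0 w) := by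
  have hstep : ∀ k, T.codingMeasure (wordCylinder (k + 1) w) =
      T.codingMeasure (wordCylinder k w) := fun k => by
    rw [wordCylinder_add_one, (T.measurePreserving_shift hT).measure_preimage
      (measurableSet_wordCylinder k w).nullMeasurableSet]
  induction k using Int.induction_on with
  | zero => rfl
  | succ k ih => rw [hstep, ih]
  | pred k ih => rw [← ih, ← hstep, sub_add_cancel]

/-- Multiply numerator and denominator of the frequency by `width n`: they tend to the measure of
the coded cylinder and of the space. Shift invariance reduces any position k to 0. -/
lemma isEmpiricalMeasure_codingMeasure : T.IsEmpiricalMeasure T.codingMeasure := by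
  intro w k
  have hV : (volume T.space).toReal ≠ 0 :=
    (ENNReal.toReal_pos T.volume_space_ne_zero hT.ne).ne'
  have hS : volume (T.coding ⁻¹' wordCylinder 0 w ∩ T.space) ≠ ⊤ :=
    ((measure_mono inter_subset_right).trans_lt hT).ne
  have hm := T.measurable_coding (measurableSet_wordCylinder 0 w)
  have h1 := ((ENNReal.tendsto_toReal hS).comp (T.tendsto_count_mul_width hT w)).div
    (T.tendsto_height_sub_mul_width hT w.length) hV
  have h2 : T.codingMeasure.real (wordCylinder k w) =
      (volume (T.coding ⁻¹' wordCylinder 0 w ∩ T.space)).toReal / (volume T.space).toReal := by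
    rw [measureReal_def, T.codingMeasure_wordCylinder hT, codingMeasure,
      Measure.map_apply T.measurable_coding (measurableSet_wordCylinder 0 w), measure,
      Measure.smul_apply, Measure.restrict_apply hm, smul_eq_mul, ENNReal.toReal_mul,
      ENNReal.toReal_inv, div_eq_inv_mul]
  rw [h2]
  refine h1.congr fun n => ?_
  have hw := T.width_pos n
  simp only [Function.comp, Pi.div_apply, ENNReal.toReal_mul, ENNReal.toReal_natCast]
  rw [ENNReal.toReal_ofReal hw.le, mul_div_mul_right _ _ hw.ne']

end Finite

end RankOne

/-! ### Choice of the parameters -/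

namespace RankOne

/-- Here H n and d n are the intended lengths of B_n and D_n. The factor n! gives divisibility by
every l ≤ n. With N M a threshold beyond which f exceeds M, the factor N (H n) + 2 pushes d n past N
(H n), and N (d n) + 2 pushes H (n + 1) past N (d n). -/
lemma exists_parameters {f : ℕ → ℝ} (hf : Tendsto f atTop atTop) :
    ∃ P K H d : ℕ → ℕ, (∀ n ≥ 1, 2 ≤ P n) ∧ (∀ n ≥ 1, 2 ≤ K n) ∧
      (∀ l, 1 ≤ l → ∀ n ≥ l, l ∣ P n) ∧ (∀ l, 1 ≤ l → ∀ n ≥ l, l ∣ K n) ∧ H 1 = 1 ∧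
      (∀ n ≥ 1, d n + 1 = P n * (H n + 1)) ∧ (∀ n ≥ 1, H (n + 1) = K n * d n) ∧
      (∀ n ≥ 1, ∀ q ≥ d n, (H n : ℝ) < f q) ∧ ∀ n ≥ 1, ∀ q ≥ H (n + 1), (d n : ℝ) < f q := by
  have hN : ∀ M : ℕ, ∃ N, ∀ q ≥ N, (M : ℝ) < f q := fun M =>
    eventually_atTop.1 (hf.eventually_gt_atTop (M : ℝ))
  choose N hN using hN
  let P' : ℕ → ℕ → ℕ := fun n h => n.factorial * (N h + 2)
  let d' : ℕ → ℕ → ℕ := fun n h => P' n h * (h + 1) - 1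
  let K' : ℕ → ℕ → ℕ := fun n h => n.factorial * (N (d' n h) + 2)
  -- The index is shifted by one: H n is `H' (n - 1)`, so that the recursion starts from H 1 = 1.
  let H' : ℕ → ℕ := fun n => Nat.rec 1 (fun m h => K' (m + 1) h * d' (m + 1) h) n
  have hP' : ∀ n h, N h + 2 ≤ P' n h := fun n h => Nat.le_mul_of_pos_left _ n.factorial_pos
  have hK' : ∀ n h, N (d' n h) + 2 ≤ K' n h := fun n h => Nat.le_mul_of_pos_left _ n.factorial_pos
  have hd' : ∀ n h, P' n h ≤ d' n h + 1 := fun n h => by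
    have : P' n h ≤ P' n h * (h + 1) := Nat.le_mul_of_pos_right _ (by omega)
    simp only [d']
    omega
  refine ⟨fun n => P' n (H' (n - 1)), fun n => K' n (H' (n - 1)), fun n => H' (n - 1),
    fun n => d' n (H' (n - 1)), fun n _ => ?_, fun n _ => ?_, fun l hl n hn => ?_,
    fun l hl n hn => ?_, rfl, fun n _ => ?_, fun n hn => ?_, fun n _ q hq => ?_, fun n hn q hq => ?_⟩
  · exact le_trans (by omega) (hP' n _)
  · exact le_trans (by omega) (hK' n _)
  · exact (Nat.dvd_factorial hl hn).mul_right _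
  · exact (Nat.dvd_factorial hl hn).mul_right _
  · have h1 := hP' n (H' (n - 1))
    have : 0 < P' n (H' (n - 1)) * (H' (n - 1) + 1) := by positivity
    simp only [d']
    omega
  · obtain ⟨n, rfl⟩ := Nat.exists_eq_add_of_le' hn
    rfl
  · refine hN _ q (le_trans ?_ hq)
    have h1 := hP' n (H' (n - 1))
    have h2 := hd' n (H' (n - 1))
    change N (H' (n - 1)) ≤ d' n (H' (n - 1))
    omega
  · refine hN _ q (le_trans ?_ hq)
    obtain ⟨n, rfl⟩ := Nat.exists_eq_add_of_le' hn
    simp only [Nat.add_sub_cancel]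
    change _ ≤ K' (n + 1) (H' n) * d' (n + 1) (H' n)
    have h1 := hP' (n + 1) (H' n)
    have h2 := hd' (n + 1) (H' n)
    have h3 := hK' (n + 1) (H' n)
    have h4 : K' (n + 1) (H' n) ≤ K' (n + 1) (H' n) * d' (n + 1) (H' n) :=
      Nat.le_mul_of_pos_right _ (by omega)
    omega

end RankOne

/-! ### The theorem, with the estimate of p(q) by ranges of q -/

open RankOne in
theorem theorem5p11 (f : ℕ → ℝ) (hf : Tendsto f atTop atTop) :
    ∃ T : RankOne,
      IsProbabilityMeasure T.measure ∧
      TotallyErgodic T.map T.measure ∧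
      (∃ ν : Measure (ℤ → Fin 2), IsProbabilityMeasure ν ∧ T.IsEmpiricalMeasure ν ∧
        ν T.subshiftᶜ = 0 ∧ TotallyErgodic shift ν) ∧
      (∀ᶠ q : ℕ in atTop, (complexity T.subshift q : ℝ) < (3 / 2 : ℝ) * (q : ℝ) + f q) ∧
      ∀ n : ℕ, 2 ≤ n →
        (complexity T.subshift (T.height n) : ℝ) < (T.height n : ℝ) + f (T.height n) := by
  obtain ⟨P, K, H, d, hP2, hK2, hP, hK, hH1, hd, hH, hfH, hfd⟩ := exists_parameters hf
  have h : ∀ n, 1 ≤ n → 2 ≤ P n * K n := fun n hn => by nlinarith [hP2 n hn, hK2 n hn]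
  set T := sparse P K h with hTdef
  have hT := T.volume_space_lt_top (sparse_s_le h)
  have herg : TotallyErgodic T.map T.measure := sparse_totallyErgodic h hP hK
  have hlen : ∀ n ≥ 1, T.height n = H n → (spacedPower (T.block n) (P n)).length = d n := by
    intro n hn hh
    have h1 := length_spacedPower (T.block n) (P := P n) (by have := hP2 n hn; omega)
    have h2 := hd n hn
    rw [← hh] at h2
    simp only [height] at h2
    omega
  have hheight : ∀ n ≥ 1, T.height n = H n := by
    intro n hn
    induction n, hn using Nat.le_induction with
    | base => rw [hH1]; simp [height, block]
    | succ n hn ih =>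
      rw [hH n hn, height, hTdef, sparse_block_succ h hn, ← hTdef]
      simp [hlen n hn ih]
  replace hlen : ∀ n ≥ 1, (spacedPower (T.block n) (P n)).length = d n :=
    fun n hn => hlen n hn (hheight n hn)
  have hne : ∀ n ≥ 1, spacedPower (T.block n) (P n) ≠ [] := fun n hn =>
    spacedPower_ne_nil (List.length_pos_iff.1 (T.height_pos hn)) _
  have hlow : ∀ n ≥ 1, ∀ q ≤ H (n + 1), complexity T.subshift q ≤ q + d n := by
    intro n hn q hq
    rw [← hlen n hn]
    exact (sparse_nearPeriodic h hn (by rwa [← hheight _ (by omega)] at hq)).complexity_le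
      (hne n hn)
  refine ⟨T, T.isProbabilityMeasure_measure hT, herg,
    ⟨T.codingMeasure, T.isProbabilityMeasure_codingMeasure hT,
      T.isEmpiricalMeasure_codingMeasure hT, T.codingMeasure_compl_subshift hT,
      T.totallyErgodic_shift hT herg⟩, ?_, ?_⟩
  · filter_upwards [eventually_ge_atTop (H 2)] with q hq
    have hgrow : ∀ n ≥ 1, H n ≤ d n ∧ 2 * d n ≤ H (n + 1) := by
      intro n hn
      have h1 := hd n hn
      have h2 := hP2 n hn
      have h3 := Nat.mul_le_mul_right (H n + 1) h2
      have h4 := hK2 n hn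
      rw [hH n hn]
      exact ⟨by omega, Nat.mul_le_mul_right _ h4⟩
    have hex : ∃ n, 1 ≤ n ∧ q < H (n + 1) := by
      have hlin : ∀ n, n ≤ H (n + 1) := by
        intro n
        induction n with
        | zero => simp
        | succ n ih =>
          have h1 := hgrow (n + 1) (by omega)
          have h2 := hheight (n + 1) (by omega)
          have h3 := T.height_pos (n := n + 1) (by omega)
          omega
      exact ⟨q + 1, by omega, hlin (q + 1)⟩
    classical
    obtain ⟨hn1, hqn⟩ := Nat.find_spec hex
    have hmin := fun m (hm : m < Nat.find hex) => Nat.find_min hex hm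
    generalize Nat.find hex = n at hn1 hqn hmin
    -- Now n is the least index with q < H (n + 1). It is at least 2 because q ≥ H 2, so B_n is a
    -- power of D_{n-1}.
    obtain ⟨m, rfl⟩ : ∃ m, n = m + 2 := by
      rcases Nat.lt_or_ge n 2 with h2 | h2
      · have : n = 1 := by omega
        subst this
        exact absurd hqn (not_lt.2 hq)
      · exact ⟨n - 2, by omega⟩
    have hHq : H (m + 2) ≤ q := by
      by_contra hlt
      exact hmin (m + 1) (by omega) ⟨by omega, not_le.1 hlt⟩
    obtain ⟨g1, g2⟩ := hgrow (m + 2) (by omega)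
    have hfdq := hfd (m + 1) (by omega) q hHq
    have hd0 : (0 : ℝ) ≤ d (m + 1) := by positivity
    have hX := sparse_nearPeriodic h (n := m + 2) (by omega) (q := q)
      (by rw [← hTdef, hheight _ (by omega)]; exact hqn.le)
    rw [← hTdef] at hX
    have hPpos : 1 ≤ P (m + 2) := by have := hP2 (m + 2) (by omega); omega
    have hD := spacedPower_append (T.block (m + 2)) hPpos
    have hDne := hne (m + 2) (by omega)
    have hB : (T.block (m + 2)).length = H (m + 2) := hheight (m + 2) (by omega)
    have hDlen := hlen (m + 2) (by omega)
    rcases Nat.lt_or_ge (d (m + 2)) q with hqd | hqd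
    · rcases Nat.lt_or_ge (2 * d (m + 2)) q with hq2 | hq2
      -- Here d_n < q/2, so q + d_n is already below 3q/2.
      · have h1 := hlow (m + 2) (by omega) q hqn.le
        have h2 : 2 * complexity T.subshift q ≤ 3 * q := by omega
        have h3 : (2 : ℝ) * complexity T.subshift q ≤ 3 * q := by exact_mod_cast h2
        linarith
      -- For d_n < q ≤ 2d_n one has 2q - d_n ≤ 3q/2, and the remaining h_n is less than f(q) since q
      -- ≥ d_n.
      · have h1 := hX.complexity_le_of_gt hDne hPpos hD (by omega)
        have h2 : 2 * complexity T.subshift q ≤ 3 * q + 2 * H (m + 2) := by omega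
        have h3 : (2 : ℝ) * complexity T.subshift q ≤ 3 * q + 2 * H (m + 2) := by exact_mod_cast h2
        have h4 := hfH (m + 2) (by omega) q hqd.le
        linarith
    rcases Nat.lt_or_ge (2 * H (m + 2) + 1) q with hq2 | hq2
    -- Here h_n < q/2, so q + h_n suffices.
    · have h1 := hX.complexity_le_of_le hDne hPpos hD (by omega) (by omega)
      have h2 : 2 * complexity T.subshift q ≤ 3 * q := by omega
      have h3 : (2 : ℝ) * complexity T.subshift q ≤ 3 * q := by exact_mod_cast h2
      linarith
    rcases hHq.eq_or_lt with hqe | hqe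
    -- The endpoint q = h_n is covered by the bound from the previous scale.
    · have h1 := hlow (m + 1) (by omega) q hqe.ge
      have h3 : (complexity T.subshift q : ℝ) ≤ q + d (m + 1) := by exact_mod_cast h1
      have h4 : (0 : ℝ) ≤ q := by positivity
      linarith
    -- For h_n < q ≤ 2h_n + 1 one has 2q - h_n - 1 < 3q/2, and the remaining d_{n-1} is less than
    -- f(q) since q ≥ h_n.
    · have h1 := hX.complexity_le_of_le_of_gt hDne hPpos hD (by omega) (hne (m + 1) (by omega))
        (K := K (m + 1)) (by have := hK2 (m + 1) (by omega); omega)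
        (sparse_block_succ h (by omega)) (by omega)
      have h5 := hlen (m + 1) (by omega)
      have h2 : 2 * complexity T.subshift q ≤ 3 * q + 2 * d (m + 1) := by omega
      have h3 : (2 : ℝ) * complexity T.subshift q ≤ 3 * q + 2 * d (m + 1) := by exact_mod_cast h2
      linarith
  · intro n hn
    obtain ⟨m, rfl⟩ := Nat.exists_eq_add_of_le' hn
    rw [hheight (m + 2) (by omega)]
    have h1 := hlow (m + 1) (by omega) (H (m + 2)) le_rfl
    have h2 : (complexity T.subshift (H (m + 2)) : ℝ) ≤ H (m + 2) + d (m + 1) := by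
      exact_mod_cast h1
    have h3 := hfd (m + 1) (by omega) (H (m + 2)) le_rfl
    linarith
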